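/- Let $\pi$ be a convex polygon with $n\ge 3$ vertices. An edge on $\pi$ is a set of two distinct vertices of $\pi$; it is a boundary edge if its convex hull is disjoint from the interior of $\pi$. Two edges cross if the relative interiors of their convex hulls intersect. A triangulation of $\pi$ is an inclusion-maximal set of pairwise non-crossing edges on $\pi$, and its interior edges are those that are not boundary edges. The flip-graph of $\pi$ is the graph whose vertices are the triangulations of $\pi$, two of them being adjacent when they differ by a single edge (one edge is removed and replaced by another one). The eccentricity of a triangulation $T$ is the largest distance in the flip-graph from $T$ to a triangulation of $\pi$. Let $T$ be a triangulation of $\pi$ and let $k$ be an integer. If every vertex of $\pi$ is incident to at most $n-3-k$ interior edges of $T$, then $T$ has (finite) eccentricity at least $$n+\frac{k-21}{4}$$ in the flip-graph of $\pi$. -/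

import Mathlib

/-- The Euclidean plane. -/
abbrev Plane : Type := EuclideanSpace ℝ (Fin 2)

/-- Twice the signed area of the triangle `p q r`; it is positive if and only if `p`, `q`, `r` are
the vertices of a non-degenerate triangle listed in counterclockwise order. -/
def signedArea (p q r : Plane) : ℝ :=
  (q 0 - p 0) * (r 1 - p 1) - (q 1 - p 1) * (r 0 - p 0)

/-- A convex polygon with `n ≥ 3` vertices, which are labeled counterclockwise by `0, …, n - 1`
from an arbitrary first vertex: any three vertices in the order of their labels form a
non-degenerate counterclockwise triangle (so no vertex lies in the convex hull of the others). -/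
structure ConvexPolygon (n : ℕ) where
  vertex : Fin n → Plane
  three_le : 3 ≤ n
  ccw : ∀ i j k : Fin n, i < j → j < k → 0 < signedArea (vertex i) (vertex j) (vertex k)

namespace ConvexPolygon

/-- The polygon as a region of the plane. -/
def region {n : ℕ} (P : ConvexPolygon n) : Set Plane :=
  convexHull ℝ (Set.range P.vertex)

/-- The convex hull of a pair of vertices. -/
def hull {n : ℕ} (P : ConvexPolygon n) (e : Sym2 (Fin n)) : Set Plane :=
  Sym2.lift ⟨fun i j => segment ℝ (P.vertex i) (P.vertex j),
    fun i j => segment_symm ℝ (P.vertex i) (P.vertex j)⟩ e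

/-- The relative interior of the convex hull of a pair of vertices. -/
def openHull {n : ℕ} (P : ConvexPolygon n) (e : Sym2 (Fin n)) : Set Plane :=
  Sym2.lift ⟨fun i j => openSegment ℝ (P.vertex i) (P.vertex j),
    fun i j => openSegment_symm ℝ (P.vertex i) (P.vertex j)⟩ e

/-- An edge *of* the polygon (a boundary edge): a pair of distinct vertices whose convex hull is
disjoint from the interior of the polygon. -/
def IsBoundaryEdge {n : ℕ} (P : ConvexPolygon n) (e : Sym2 (Fin n)) : Prop :=
  ¬ e.IsDiag ∧ Disjoint (P.hull e) (interior P.region)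

/-- Two edges cross when the relative interiors of their convex hulls meet. -/
def Crossing {n : ℕ} (P : ConvexPolygon n) (e f : Sym2 (Fin n)) : Prop :=
  ¬ Disjoint (P.openHull e) (P.openHull f)

/-- `S` is a set of edges *on* the polygon (pairs of distinct vertices), pairwise non-crossing. -/
def IsNonCrossing {n : ℕ} (P : ConvexPolygon n) (S : Finset (Sym2 (Fin n))) : Prop :=
  (∀ e ∈ S, ¬ e.IsDiag) ∧ ∀ e ∈ S, ∀ f ∈ S, e ≠ f → ¬ P.Crossing e f

/-- A triangulation: an inclusion-maximal set of pairwise non-crossing edges on the polygon. -/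
structure Triangulation {n : ℕ} (P : ConvexPolygon n) where
  edges : Finset (Sym2 (Fin n))
  maximal : Maximal P.IsNonCrossing edges

open Classical in
/-- The interior edges of a triangulation: its edges that are not boundary edges. -/
noncomputable def Triangulation.interiorEdges {n : ℕ} {P : ConvexPolygon n}
    (T : P.Triangulation) : Finset (Sym2 (Fin n)) :=
  T.edges.filter fun e => ¬ P.IsBoundaryEdge e

/-- The number of interior edges of `T` incident to the vertex `v`. -/
noncomputable def Triangulation.interiorDegree {n : ℕ} {P : ConvexPolygon n}
    (T : P.Triangulation) (v : Fin n) : ℕ :=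
  (T.interiorEdges.filter fun e => v ∈ e).card

/-- The flip-graph: two triangulations are adjacent when they differ by a single edge, i.e. each is
obtained from the other by removing one edge and inserting another one. -/
def flipGraph {n : ℕ} (P : ConvexPolygon n) : SimpleGraph P.Triangulation where
  Adj T U := (T.edges \ U.edges).card = 1 ∧ (U.edges \ T.edges).card = 1
  symm := ⟨fun _ _ h => ⟨h.2, h.1⟩⟩
  loopless := ⟨fun T h => by simp at h⟩

end ConvexPolygon

/-! Crossing depends only on the cyclic order of the labels. So a triangulation becomes a maximal
non-crossing relation on a finite set V of naturals, and a walk in the flip-graph becomes a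
`FlipPath`. If D bounds the interior degrees, some triangulation is at least (5|V| - 24 - D)/4 flips
away (`Tri.exists_far_of_degree_le`); D = n - 3 - k gives the theorem.

One vertex (`Tri.exists_far`). Let v have s neighbours, boundary ones included, and κ
non-neighbours, and let q ≤ min(κ, s - 3). The target makes v an ear and contains diagonals that all
cross edges at v. They are charged to the non-neighbours, once to each and twice to q of them. On a
path to the target, let U be the set of vertices never joined to v. At least κ - |U| flips insert an
edge at v, and at least s + κ - |U| - 2 remove one. The target diagonals at U need further flips,
because a flip that removes an edge at v inserts an edge between two neighbours of v. In total this
is at least |V| - 3 + q (`FlipPath.count`, `exists_diagonals`).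

Localisation (`Tri.exists_far_of_outer`). An edge a c cuts off a pocket with M vertices strictly
inside. Contracting the pocket, or contracting everything beyond a c to a single vertex z, turns
flip paths into flip paths. No flip survives both contractions, so the two flip counts add up. If
some vertex of the pocket has between M/4 + 1 and 3M/4 long edges in it, the one-vertex bound with q
= ⌈M/4⌉ yields 5M/4 flips there, and induction treats the remaining polygon.

If no pocket has such a vertex, long degrees jump over the forbidden range: every non-empty pocket
has a vertex with more than 3M/4 long edges (`Tri.exists_dominating`). The larger pocket next to the
triangle on a boundary edge then contains a vertex of degree above 3|V|/8, and the one-vertex bound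
there, combined with the degree bound D, finishes the proof.

The eccentricity is finite because there are finitely many triangulations and each can be flipped to
the fan at vertex 0. -/

namespace FlipGraph

/-! ### Combinatorial triangulations on sets of naturals -/

/-- The pairs `p q` and `r s` of natural numbers are interleaved: when the naturals are placed in
convex position, the corresponding segments cross. -/
def Cr (p q r s : ℕ) : Prop :=
  ((p < r ∧ r < q ∨ q < r ∧ r < p) ∧ (s < p ∧ s < q ∨ p < s ∧ q < s)) ∨
  ((p < s ∧ s < q ∨ q < s ∧ s < p) ∧ (r < p ∧ r < q ∨ p < r ∧ q < r))

/-- A symmetric relation on `V` whose related pairs are pairwise non-crossing. -/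
structure NC (V : Finset ℕ) (E : ℕ → ℕ → Prop) : Prop where
  symm : ∀ {x y}, E x y → E y x
  mem : ∀ {x y}, E x y → x ∈ V
  ne : ∀ {x y}, E x y → x ≠ y
  nc : ∀ {p q r s}, E p q → E r s → ¬ Cr p q r s

/-- A triangulation of the vertex set `V`, as a maximal non-crossing relation. -/
structure Tri (V : Finset ℕ) (E : ℕ → ℕ → Prop) : Prop extends NC V E where
  max : ∀ {x y}, x ∈ V → y ∈ V → x ≠ y → (∀ r s, E r s → ¬ Cr x y r s) → E x y

theorem cr_iff {p q r s : ℕ} (h : p < q) (h' : r < s) :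
    Cr p q r s ↔ (p < r ∧ r < q ∧ q < s) ∨ (r < p ∧ p < s ∧ s < q) := by
  unfold Cr
  omega

theorem cr_swap_right {p q r s : ℕ} : Cr p q r s ↔ Cr p q s r := by
  unfold Cr
  tauto

theorem cr_swap_left {p q r s : ℕ} : Cr p q r s ↔ Cr q p r s := by
  unfold Cr
  tauto

theorem cr_comm {p q r s : ℕ} : Cr p q r s ↔ Cr r s p q := by
  unfold Cr
  omega

theorem NC.not_interleaved {V E} (h : NC V E) {p q r s : ℕ} (h1 : E p q) (h2 : E r s) :
    ¬ (p < r ∧ r < q ∧ q < s) := fun h3 =>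
  h.nc h1 h2 ((cr_iff (by omega) (by omega)).2 (Or.inl h3))

theorem NC.mem_right {V E} (h : NC V E) {x y : ℕ} (hxy : E x y) : y ∈ V := h.mem (h.symm hxy)

/-- Adding a pair to a relation, symmetrically. -/
def insertPair (E : ℕ → ℕ → Prop) (p q : ℕ) : ℕ → ℕ → Prop :=
  fun x y => E x y ∨ (x = p ∧ y = q) ∨ (x = q ∧ y = p)

theorem NC.insertPair {V E} (h : NC V E) {p q : ℕ} (hp : p ∈ V) (hq : q ∈ V) (hpq : p ≠ q)
    (hc : ∀ r s, E r s → ¬ Cr p q r s) : NC V (insertPair E p q) where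
  symm := by
    rintro x y (h1 | ⟨rfl, rfl⟩ | ⟨rfl, rfl⟩)
    · exact Or.inl (h.symm h1)
    · exact Or.inr (Or.inr ⟨rfl, rfl⟩)
    · exact Or.inr (Or.inl ⟨rfl, rfl⟩)
  mem := by
    rintro x y (h1 | ⟨rfl, rfl⟩ | ⟨rfl, rfl⟩)
    · exact h.mem h1
    · exact hp
    · exact hq
  ne := by
    rintro x y (h1 | ⟨rfl, rfl⟩ | ⟨rfl, rfl⟩)
    · exact h.ne h1
    · exact hpq
    · exact hpq.symm
  nc := by
    have key : ∀ r s, E r s → ¬ Cr p q r s ∧ ¬ Cr q p r s ∧ ¬ Cr r s p q ∧ ¬ Cr r s q p := by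
      intro r s hrs
      have := hc r s hrs
      unfold Cr at *
      omega
    have key2 : ¬ Cr p q p q ∧ ¬ Cr p q q p ∧ ¬ Cr q p p q ∧ ¬ Cr q p q p := by
      unfold Cr
      omega
    rintro x y r s (h1 | ⟨rfl, rfl⟩ | ⟨rfl, rfl⟩) (h2 | ⟨rfl, rfl⟩ | ⟨rfl, rfl⟩)
    · exact h.nc h1 h2
    · exact (key _ _ h1).2.2.1
    · exact (key _ _ h1).2.2.2
    · exact (key _ _ h2).1
    · exact key2.1
    · exact key2.2.1
    · exact (key _ _ h2).2.1
    · exact key2.2.2.1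
    · exact key2.2.2.2

/-- Every non-crossing relation extends to a triangulation. -/
theorem NC.extend {V E} (h : NC V E) : ∃ E', Tri V E' ∧ ∀ x y, E x y → E' x y := by
  classical
  let X : Set (Finset (ℕ × ℕ)) := {S | S ⊆ V ×ˢ V ∧ NC V (fun x y => (x, y) ∈ S)}
  have hfin : X.Finite := (Finset.finite_toSet (V ×ˢ V).powerset).subset fun S hS => by
    exact Finset.mem_coe.2 (Finset.mem_powerset.2 hS.1)
  let S0 := (V ×ˢ V).filter (fun p => E p.1 p.2)
  have hS0 : (fun x y => (x, y) ∈ S0) = E := by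
    funext x y
    simp only [S0, Finset.mem_filter, Finset.mem_product, eq_iff_iff, and_iff_right_iff_imp]
    exact fun hxy => ⟨h.mem hxy, h.mem_right hxy⟩
  have hX0 : S0 ∈ X := ⟨Finset.filter_subset _ _, by rw [hS0]; exact h⟩
  obtain ⟨S, hle, hS⟩ := hfin.exists_le_maximal hX0
  refine ⟨fun x y => (x, y) ∈ S, { hS.1.2 with max := ?_ }, ?_⟩
  · intro x y hx hy hne hc
    have h1 := hS.1.2.insertPair hx hy hne hc
    have h2 : (fun u v => (u, v) ∈ S ∪ {(x, y), (y, x)}) =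
        FlipGraph.insertPair (fun x y => (x, y) ∈ S) x y := by
      funext u v
      simp only [FlipGraph.insertPair, Finset.mem_union, Finset.mem_insert, Finset.mem_singleton,
        Prod.mk.injEq]
    have h3 : S ∪ {(x, y), (y, x)} ∈ X := by
      refine ⟨Finset.union_subset hS.1.1 ?_, by rw [h2]; exact h1⟩
      intro p hp
      simp only [Finset.mem_insert, Finset.mem_singleton] at hp
      rcases hp with rfl | rfl <;> simp [hx, hy]
    have := hS.2 h3 Finset.subset_union_left
    exact this (by simp)
  · intro x y hxy
    apply hle
    simp only [S0, Finset.mem_filter, Finset.mem_product]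
    exact ⟨⟨h.mem hxy, h.mem_right hxy⟩, hxy⟩

theorem Tri.of_not_interleaved {V E} (h : Tri V E) {x y : ℕ} (hx : x ∈ V) (hy : y ∈ V)
    (hxy : x < y) (hc : ∀ r s, E r s → r < s → ¬ (x < r ∧ r < y ∧ y < s) ∧
      ¬ (r < x ∧ x < s ∧ s < y)) : E x y := by
  refine h.max hx hy hxy.ne fun r s hrs => ?_
  rcases lt_or_gt_of_ne (h.ne hrs) with h1 | h1
  · rw [cr_iff hxy h1, not_or]
    exact hc r s hrs h1
  · rw [cr_swap_right, cr_iff hxy h1, not_or]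
    exact hc s r (h.symm hrs) h1

theorem Tri.of_no_between {V E} (h : Tri V E) {x y : ℕ} (hx : x ∈ V) (hy : y ∈ V) (hxy : x < y)
    (hb : ∀ w ∈ V, ¬ (x < w ∧ w < y)) : E x y := by
  refine h.of_not_interleaved hx hy hxy fun r s hrs hlt => ?_
  have h1 := hb r (h.mem hrs)
  have h2 := hb s (h.mem_right hrs)
  omega

theorem Tri.of_no_outside {V E} (h : Tri V E) {x y : ℕ} (hx : x ∈ V) (hy : y ∈ V) (hxy : x < y)
    (hb : ∀ w ∈ V, x ≤ w ∧ w ≤ y) : E x y := by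
  refine h.of_not_interleaved hx hy hxy fun r s hrs hlt => ?_
  have h1 := hb r (h.mem hrs)
  have h2 := hb s (h.mem_right hrs)
  omega

theorem exists_succ {V : Finset ℕ} {a w : ℕ} (hw : w ∈ V) (haw : a < w) :
    ∃ s ∈ V, a < s ∧ s ≤ w ∧ ∀ u ∈ V, ¬ (a < u ∧ u < s) := by
  obtain ⟨s, hs, hm⟩ := (V.filter (a < ·)).exists_min_image id ⟨w, by simp [hw, haw]⟩
  simp only [Finset.mem_filter, id] at hs hm
  exact ⟨s, hs.1, hs.2, hm w ⟨hw, haw⟩, fun u hu hu2 => by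
    have := hm u ⟨hu, hu2.1⟩; omega⟩

theorem exists_pred {V : Finset ℕ} {a w : ℕ} (hw : w ∈ V) (haw : w < a) :
    ∃ s ∈ V, s < a ∧ w ≤ s ∧ ∀ u ∈ V, ¬ (s < u ∧ u < a) := by
  obtain ⟨s, hs, hm⟩ := (V.filter (· < a)).exists_max_image id ⟨w, by simp [hw, haw]⟩
  simp only [Finset.mem_filter, id] at hs hm
  exact ⟨s, hs.1, hs.2, hm w ⟨hw, haw⟩, fun u hu hu2 => by
    have := hm u ⟨hu, hu2.2⟩; omega⟩

/-- The third vertex of the triangle below an edge. -/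
theorem Tri.apex {V E} (h : Tri V E) {a c w : ℕ} (hac : E a c) (hw : w ∈ V) (h1 : a < w)
    (h2 : w < c) : ∃ b ∈ V, a < b ∧ b < c ∧ E a b ∧ E b c := by
  classical
  obtain ⟨s, hs, has, hsw, hsb⟩ := exists_succ hw h1
  have hEs : E a s := h.of_no_between (h.mem hac) hs has hsb
  -- The apex is the farthest neighbour of a before c: an edge blocking b c from outside would have
  -- to start at a and end beyond b.
  obtain ⟨b, hb, hm⟩ := (V.filter (fun x => a < x ∧ x < c ∧ E a x)).exists_max_image id
    ⟨s, by simp only [Finset.mem_filter]; exact ⟨hs, has, by omega, hEs⟩⟩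
  simp only [Finset.mem_filter, id] at hb hm
  refine ⟨b, hb.1, hb.2.1, hb.2.2.1, hb.2.2.2,
    h.of_not_interleaved hb.1 (h.mem_right hac) hb.2.2.1 fun r s hrs hlt => ⟨fun hc => ?_, fun hc => ?_⟩⟩
  · exact h.not_interleaved hac hrs (by omega)
  · have e1 := h.not_interleaved hrs hac
    have e2 := h.not_interleaved hb.2.2.2 hrs
    obtain rfl : r = a := by omega
    have := hm s ⟨h.mem_right hrs, by omega, by omega, hrs⟩
    omega

/-- The third vertex of the triangle above an edge. -/
theorem Tri.apex_outside {V E} (h : Tri V E) {a c w : ℕ} (hE : E a c) (hac : a < c) (hw : w ∈ V)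
    (hwo : w < a ∨ c < w) : ∃ z ∈ V, (z < a ∨ c < z) ∧ E a z ∧ E c z := by
  classical
  have ha := h.mem hE
  have hc := h.mem_right hE
  -- In the cyclic order starting at c, the apex is the last neighbour of c before a. It is the
  -- largest neighbour below a if there is one, and otherwise the largest above c.
  by_cases hex : ∃ x ∈ V, x < a ∧ E c x
  · obtain ⟨x, hx, hxa, hcx⟩ := hex
    obtain ⟨z, hz, hm⟩ := (V.filter (fun x => x < a ∧ E c x)).exists_max_image id
      ⟨x, by simp only [Finset.mem_filter]; exact ⟨hx, hxa, hcx⟩⟩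
    simp only [Finset.mem_filter, id] at hz hm
    refine ⟨z, hz.1, Or.inl hz.2.1, h.symm (h.of_not_interleaved hz.1 ha hz.2.1
      fun r s hrs hlt => ⟨fun hcr => ?_, fun hcr => ?_⟩), hz.2.2⟩
    · have e1 := h.not_interleaved hrs hE
      have e2 := h.not_interleaved (h.symm hz.2.2) hrs
      obtain rfl : s = c := by omega
      have := hm r ⟨h.mem hrs, by omega, h.symm hrs⟩
      omega
    · exact h.not_interleaved hrs (h.symm hz.2.2) (by omega)
  · push Not at hex
    have hlast : ∃ x ∈ V, c < x := by
      by_contra hcon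
      push Not at hcon
      obtain ⟨m, hm, hmin⟩ := V.exists_min_image id ⟨a, ha⟩
      simp only [id] at hmin
      have hwa : w < a := by
        have := hcon w hw
        omega
      have hmw := hmin w hw
      refine hex m hm (by omega) (h.symm (h.of_no_outside hm hc (by omega) fun u hu => ?_))
      exact ⟨hmin u hu, hcon u hu⟩
    obtain ⟨x, hx, hcx⟩ := hlast
    obtain ⟨s, hs, has, hsw, hsb⟩ := exists_succ hx hcx
    have hEs : E c s := h.of_no_between hc hs has hsb
    obtain ⟨z, hz, hm⟩ := (V.filter (fun x => c < x ∧ E c x)).exists_max_image id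
      ⟨s, by simp only [Finset.mem_filter]; exact ⟨hs, has, hEs⟩⟩
    simp only [Finset.mem_filter, id] at hz hm
    refine ⟨z, hz.1, Or.inr hz.2.1, h.of_not_interleaved ha hz.1 (by omega)
      fun r s hrs hlt => ⟨fun hcr => ?_, fun hcr => ?_⟩, hz.2.2⟩
    · have e1 := h.not_interleaved hE hrs
      have e2 := h.not_interleaved hz.2.2 hrs
      obtain rfl : r = c := by omega
      have := hm s ⟨h.mem_right hrs, by omega, hrs⟩
      omega
    · have e1 := h.not_interleaved hrs hE
      have e2 := h.not_interleaved hrs hz.2.2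
      obtain rfl : s = c := by omega
      exact hex r (h.mem hrs) (by omega) (h.symm hrs)

/-- Cutting off the vertices below an edge of a triangulation leaves a triangulation. -/
theorem Tri.restrict {V E} (h : Tri V E) {a c : ℕ} (hE : E a c) (hac : a < c) :
    Tri (V.filter fun x => ¬ (a < x ∧ x < c))
      (fun x y => E x y ∧ ¬ (a < x ∧ x < c) ∧ ¬ (a < y ∧ y < c)) where
  symm := fun ⟨h1, h2, h3⟩ => ⟨h.symm h1, h3, h2⟩
  mem := fun ⟨h1, h2, _⟩ => by
    rw [Finset.mem_filter]; exact ⟨h.mem h1, h2⟩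
  ne := fun h1 => h.ne h1.1
  nc := fun h1 h2 => h.nc h1.1 h2.1
  max := by
    intro x y hx hy hne hcr
    rw [Finset.mem_filter] at hx hy
    refine ⟨h.max hx.1 hy.1 hne fun r s hrs hc => ?_, hx.2, hy.2⟩
    have h1 := hcr r s
    have h2 := h.nc hE hrs
    have h3 : (a < r ∧ r < c) ∨ (a < s ∧ s < c) := by
      by_contra hcon
      rw [not_or] at hcon
      exact h1 ⟨hrs, hcon⟩ hc
    have h4 : (a ≤ r ∧ r ≤ c) ∧ (a ≤ s ∧ s ≤ c) := by
      unfold Cr at h2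
      omega
    have h5 := hx.2
    have h6 := hy.2
    unfold Cr at hc
    omega

/-! ### Diagonals meeting prescribed demands -/

/-- Next to the positive point closest to y₀, on the side facing y₀, there is a point of demand
zero. It is the ear to be cut off in `exists_diagonals`. -/
theorem exists_adjacent_demand {Q : Finset ℕ} {δ : ℕ → ℕ}
    {x₀ y₀ : ℕ} (hx : x₀ ∈ Q) (hδx : 0 < δ x₀) (hy : y₀ ∈ Q) (hδy : δ y₀ = 0)
    (hy1 : ∃ y ∈ Q, y < y₀) (hy2 : ∃ y ∈ Q, y₀ < y) :
    ∃ c ∈ Q, ∃ lo ∈ Q, ∃ hi ∈ Q, δ c = 0 ∧ lo < c ∧ c < hi ∧ (∀ w ∈ Q, ¬ (lo < w ∧ w < c)) ∧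
      (∀ w ∈ Q, ¬ (c < w ∧ w < hi)) ∧ (0 < δ lo ∨ 0 < δ hi) := by
  obtain ⟨l, hl, hly⟩ := hy1
  obtain ⟨r, hr, hry⟩ := hy2
  have hne : x₀ ≠ y₀ := by rintro rfl; omega
  rcases lt_or_gt_of_ne hne with h | h
  · obtain ⟨p, hp, hm⟩ := (Q.filter (fun t => t < y₀ ∧ 0 < δ t)).exists_max_image id
      ⟨x₀, by simp [hx, h, hδx]⟩
    simp only [Finset.mem_filter, id] at hp hm
    obtain ⟨c, hc, h1, h2, h3⟩ := exists_succ hy hp.2.1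
    obtain ⟨q, hq, h4, h5, h6⟩ := exists_succ hr (show c < r by omega)
    refine ⟨c, hc, p, hp.1, q, hq, ?_, h1, h4, h3, h6, Or.inl hp.2.2⟩
    by_contra h0
    rcases h2.eq_or_lt with h7 | h7
    · exact h0 (h7 ▸ hδy)
    · have := hm c ⟨hc, h7, by omega⟩
      omega
  · obtain ⟨p, hp, hm⟩ := (Q.filter (fun t => y₀ < t ∧ 0 < δ t)).exists_min_image id
      ⟨x₀, by simp [hx, h, hδx]⟩
    simp only [Finset.mem_filter, id] at hp hm
    obtain ⟨c, hc, h1, h2, h3⟩ := exists_pred hy hp.2.1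
    obtain ⟨q, hq, h4, h5, h6⟩ := exists_pred hl (show l < c by omega)
    refine ⟨c, hc, q, hq, p, hp.1, ?_, h4, h1, h6, h3, Or.inr hp.2.2⟩
    by_contra h0
    rcases h2.eq_or_lt with h7 | h7
    · exact h0 (h7 ▸ hδy)
    · have := hm c ⟨hc, h7, by omega⟩
      omega

/-- At least three points have demand zero, and only two points are extreme. -/
theorem exists_interior_zero {Q : Finset ℕ} {δ : ℕ → ℕ} (hsum : ∑ x ∈ Q, δ x + 3 ≤ Q.card) :
    ∃ y ∈ Q, δ y = 0 ∧ (∃ u ∈ Q, u < y) ∧ ∃ u ∈ Q, y < u := by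
  have hne : Q.Nonempty := Finset.card_pos.1 (by omega)
  obtain ⟨m, hm, hmin⟩ := Q.exists_min_image id hne
  obtain ⟨M, hM, hmax⟩ := Q.exists_max_image id hne
  simp only [id] at hmin hmax
  by_contra hcon
  push Not at hcon
  have h1 : ∀ x ∈ (Q.erase m).erase M, 1 ≤ δ x := by
    intro x hx
    simp only [Finset.mem_erase] at hx
    by_contra h0
    have h2 := hmin x hx.2.2
    have h3 := hmax x hx.2.2
    have := hcon x hx.2.2 (by omega) ⟨m, hm, by omega⟩ M hM
    omega
  have h2 : ((Q.erase m).erase M).card ≤ ∑ x ∈ (Q.erase m).erase M, δ x := by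
    simpa using Finset.card_nsmul_le_sum _ _ 1 h1
  have h3 : ∑ x ∈ (Q.erase m).erase M, δ x ≤ ∑ x ∈ Q, δ x :=
    Finset.sum_le_sum_of_subset ((Finset.erase_subset _ _).trans (Finset.erase_subset _ _))
  have h4 := Finset.pred_card_le_card_erase (s := Q) (a := m)
  have h5 := Finset.pred_card_le_card_erase (s := Q.erase m) (a := M)
  omega

/-- Any demand of total at most `|Q| - 3` on the inner points of a set `Q` in convex position is
met by non-crossing diagonals. -/
theorem exists_diagonals (S : ℕ → Prop) (Q : Finset ℕ) (δ : ℕ → ℕ)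
    (hin : ∀ x ∈ Q, 0 < δ x → (∃ y ∈ Q, y < x) ∧ ∃ y ∈ Q, x < y)
    (hsum : ∑ x ∈ Q, δ x + 3 ≤ Q.card)
    (hinv : ∀ p ∈ Q, ∀ x ∈ Q, ∀ q ∈ Q, p < x → x < q → δ x = 0 → ∃ s, S s ∧ p < s ∧ s < q) :
    ∃ B : Finset (ℕ × ℕ), (∀ e ∈ B, e.1 ∈ Q ∧ e.2 ∈ Q ∧ (∃ x ∈ Q, e.1 < x ∧ x < e.2) ∧
        ∃ s, S s ∧ e.1 < s ∧ s < e.2) ∧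
      (∀ e ∈ B, ∀ f ∈ B, ¬ (e.1 < f.1 ∧ f.1 < e.2 ∧ e.2 < f.2)) ∧
      ∀ U : Finset ℕ, ∑ x ∈ Q.filter (· ∈ U), δ x ≤
        (B.filter fun e => e.1 ∈ U ∨ e.2 ∈ U).card := by
  induction hN : Q.card using Nat.strong_induction_on generalizing Q δ with
  | _ N ih =>
  subst hN
  by_cases h0 : ∀ x ∈ Q, δ x = 0
  · refine ⟨∅, by simp, by simp, fun U => ?_⟩
    rw [Finset.sum_eq_zero]
    · exact Nat.zero_le _
    · exact fun x hx => h0 x (Finset.mem_filter.1 hx).1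
  push Not at h0
  obtain ⟨x₀, hx₀, hδ⟩ := h0
  obtain ⟨y₀, hy₀, hδy, hy1, hy2⟩ := exists_interior_zero hsum
  -- Cut off the ear c by the diagonal lo hi and charge this diagonal to its endpoint u of positive
  -- demand. The total demand and the number of points both drop by one, which preserves `hsum`.
  obtain ⟨c, hc, lo, hlo, hi, hhi, hδc, hlc, hch, hb1, hb2, hpos⟩ :=
    exists_adjacent_demand hx₀ (Nat.pos_of_ne_zero hδ) hy₀ hδy hy1 hy2
  obtain ⟨u, hu, huc, hδu, huQ⟩ : ∃ u, (u = lo ∨ u = hi) ∧ u ≠ c ∧ 0 < δ u ∧ u ∈ Q := by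
    rcases hpos with h | h
    · exact ⟨lo, Or.inl rfl, by omega, h, hlo⟩
    · exact ⟨hi, Or.inr rfl, by omega, h, hhi⟩
  have hsep : ∃ s, S s ∧ lo < s ∧ s < hi := hinv lo hlo c hc hi hhi hlc hch hδc
  let δ' : ℕ → ℕ := fun x => if x = u then δ u - 1 else δ x
  have hδ' : ∀ x, δ' x = if x = u then δ u - 1 else δ x := fun x => rfl
  have hle : ∀ x, δ' x ≤ δ x := by
    intro x
    rw [hδ']
    split_ifs with h
    · subst h; omega
    · exact le_rfl
  have hsumeq : ∀ A : Finset ℕ, u ∈ A → ∑ x ∈ A, δ' x + 1 = ∑ x ∈ A, δ x := by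
    intro A hA
    rw [← Finset.add_sum_erase A δ' hA, ← Finset.add_sum_erase A δ hA,
      Finset.sum_congr rfl (g := fun x => δ x) fun x hx => by
        rw [hδ', if_neg (Finset.ne_of_mem_erase hx)]]
    simp only [hδ', if_true]
    omega
  have hcard : (Q.erase c).card = Q.card - 1 := Finset.card_erase_of_mem hc
  have hin' : ∀ x ∈ Q.erase c, 0 < δ' x →
      (∃ y ∈ Q.erase c, y < x) ∧ ∃ y ∈ Q.erase c, x < y := by
    intro x hx hpos'
    have h1 := hle x
    obtain ⟨⟨y, hy, hyx⟩, z, hz, hxz⟩ := hin x (Finset.mem_of_mem_erase hx) (by omega)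
    refine ⟨?_, ?_⟩
    · by_cases h : y = c
      · exact ⟨lo, Finset.mem_erase.2 ⟨by omega, hlo⟩, by omega⟩
      · exact ⟨y, Finset.mem_erase.2 ⟨h, hy⟩, hyx⟩
    · by_cases h : z = c
      · exact ⟨hi, Finset.mem_erase.2 ⟨by omega, hhi⟩, by omega⟩
      · exact ⟨z, Finset.mem_erase.2 ⟨h, hz⟩, hxz⟩
  have hsum' : ∑ x ∈ Q.erase c, δ' x + 3 ≤ (Q.erase c).card := by
    have h1 := hsumeq Q huQ
    have h2 : ∑ x ∈ Q.erase c, δ' x = ∑ x ∈ Q, δ' x := by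
      apply Finset.sum_erase
      have := hle c
      omega
    omega
  have hinv' : ∀ p ∈ Q.erase c, ∀ x ∈ Q.erase c, ∀ q ∈ Q.erase c, p < x → x < q → δ' x = 0 →
      ∃ s, S s ∧ p < s ∧ s < q := by
    intro p hp x hx q hq hpx hxq h0
    rw [Finset.mem_erase] at hp hx hq
    -- The demand of u may just have become zero. Since c is gone, points p and q on either side of
    -- u enclose both lo and hi, hence the separating point between these.
    by_cases hxu : x = u
    · have h1 := hb1 p hp.2
      have h2 := hb2 q hq.2
      have h1' := hb1 q hq.2
      have h2' := hb2 p hp.2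
      obtain ⟨s, hs, hs1, hs2⟩ := hsep
      exact ⟨s, hs, by omega, by omega⟩
    · refine hinv p hp.2 x hx.2 q hq.2 hpx hxq ?_
      rwa [hδ', if_neg hxu] at h0
  obtain ⟨B, hB1, hB2, hB3⟩ := ih (Q.erase c).card (by omega) (Q.erase c) δ' hin' hsum'
    hinv' rfl
  refine ⟨insert (lo, hi) B, ?_, ?_, ?_⟩
  · intro e he
    rw [Finset.mem_insert] at he
    rcases he with rfl | he
    · exact ⟨hlo, hhi, ⟨c, hc, hlc, hch⟩, hsep⟩
    · obtain ⟨h1, h2, ⟨x, hx, h3⟩, h4⟩ := hB1 e he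
      exact ⟨Finset.mem_of_mem_erase h1, Finset.mem_of_mem_erase h2,
        ⟨x, Finset.mem_of_mem_erase hx, h3⟩, h4⟩
  · have hno : ∀ w ∈ Q.erase c, ¬ (lo < w ∧ w < hi) := by
      intro w hw h
      rw [Finset.mem_erase] at hw
      have h1 := hb1 w hw.2
      have h2 := hb2 w hw.2
      omega
    intro e he f hf
    rw [Finset.mem_insert] at he hf
    rcases he with rfl | he <;> rcases hf with rfl | hf
    · simp only; omega
    · have := hno _ (hB1 f hf).1
      simp only; omega
    · have := hno _ (hB1 e he).2.1
      simp only; omega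
    · exact hB2 e he f hf
  · intro U
    have hnot : (lo, hi) ∉ B := by
      intro h
      obtain ⟨-, -, ⟨x, hx, h3⟩, -⟩ := hB1 _ h
      rw [Finset.mem_erase] at hx
      have h1 := hb1 x hx.2
      have h2 := hb2 x hx.2
      simp only at h3
      omega
    have h1 : ∑ x ∈ Q.filter (· ∈ U), δ' x = ∑ x ∈ (Q.erase c).filter (· ∈ U), δ' x := by
      rw [Finset.filter_erase]
      symm
      apply Finset.sum_erase
      have := hle c
      omega
    have h2 := hB3 U
    by_cases huU : u ∈ U
    · rw [← hsumeq _ (by simp [huQ, huU]), h1, Finset.filter_insert, if_pos, 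
        Finset.card_insert_of_notMem]
      · omega
      · simp [hnot]
      · rcases hu with rfl | rfl
        · exact Or.inl huU
        · exact Or.inr huU
    · have h3 : ∑ x ∈ Q.filter (· ∈ U), δ x = ∑ x ∈ Q.filter (· ∈ U), δ' x := by
        refine Finset.sum_congr rfl fun x hx => ?_
        rw [hδ', if_neg]
        rintro rfl
        exact huU (Finset.mem_filter.1 hx).2
      rw [h3, h1]
      exact h2.trans (Finset.card_le_card (Finset.filter_subset_filter _
        (Finset.subset_insert _ _)))

/-! ### Flip paths and their images -/

/-- `G'` arises from `G` by exchanging the diagonals `a c` and `b d` of a quadrilateral whose sides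
belong to both; the removed diagonal may stay and the inserted one may be missing. -/
structure Flip (G G' : ℕ → ℕ → Prop) (a b c d : ℕ) : Prop where
  cr : Cr a c b d
  ab : G a b ∧ G' a b
  bc : G b c ∧ G' b c
  cd : G c d ∧ G' c d
  da : G d a ∧ G' d a
  new : ∀ x y, G' x y → G x y ∨ (x = b ∧ y = d) ∨ (x = d ∧ y = b)
  old : ∀ x y, G x y → G' x y ∨ (x = a ∧ y = c) ∨ (x = c ∧ y = a)

/-- A sequence of relations on `V` that changes only at the times in `J`, and there by a flip. -/
structure FlipPath (V : Finset ℕ) (l : ℕ) (G : ℕ → ℕ → ℕ → Prop) (a b c d : ℕ → ℕ)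
    (J : Finset ℕ) : Prop where
  symm : ∀ {t x y}, G t x y → G t y x
  mem : ∀ {t x y}, G t x y → x ∈ V
  ne : ∀ {t x y}, G t x y → x ≠ y
  step : ∀ t < l, (t ∈ J ∧ Flip (G t) (G (t + 1)) (a t) (b t) (c t) (d t)) ∨ G (t + 1) = G t

/-- The image of a relation, without loops. -/
def im (χ : ℕ → ℕ) (E : ℕ → ℕ → Prop) : ℕ → ℕ → Prop :=
  fun x y => x ≠ y ∧ ∃ x' y', E x' y' ∧ χ x' = x ∧ χ y' = y

theorem Cr.pairwise_ne {a b c d : ℕ} (h : Cr a c b d) :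
    a ≠ b ∧ b ≠ c ∧ c ≠ d ∧ d ≠ a ∧ a ≠ c ∧ b ≠ d := by
  unfold Cr at h
  omega

/-- Maps under which crossing pairs either cross or collapse. -/
def Collapsing (χ : ℕ → ℕ) : Prop := ∀ a b c d, Cr a c b d →
  Cr (χ a) (χ c) (χ b) (χ d) ∨ χ a = χ b ∨ χ b = χ c ∨ χ c = χ d ∨ χ d = χ a

/-- If the crossing does not survive, two consecutive corners are identified and each diagonal has
the same image as a side. The sides are present before and after the flip, so the image does not
change and the time can be dropped from `J`. -/
theorem FlipPath.im {V W l G a b c d J} (h : FlipPath V l G a b c d J) {χ : ℕ → ℕ}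
    (hχ : Collapsing χ) (hVW : ∀ x ∈ V, χ x ∈ W) [DecidablePred fun t =>
      Cr (χ (a t)) (χ (c t)) (χ (b t)) (χ (d t))] :
    FlipPath W l (fun t => im χ (G t)) (χ ∘ a) (χ ∘ b) (χ ∘ c) (χ ∘ d)
      (J.filter fun t => Cr (χ (a t)) (χ (c t)) (χ (b t)) (χ (d t))) where
  symm := by
    rintro t x y ⟨hne, x', y', hE, rfl, rfl⟩
    exact ⟨hne.symm, y', x', h.symm hE, rfl, rfl⟩
  mem := by
    rintro t x y ⟨hne, x', y', hE, rfl, rfl⟩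
    exact hVW _ (h.mem hE)
  ne := fun h1 => h1.1
  step := by
    intro t ht
    rcases h.step t ht with ⟨hJ, hf⟩ | heq
    · by_cases hc : Cr (χ (a t)) (χ (c t)) (χ (b t)) (χ (d t))
      · left
        obtain ⟨n1, n2, n3, n4, -, -⟩ := hc.pairwise_ne
        refine ⟨Finset.mem_filter.2 ⟨hJ, hc⟩, hc, ⟨⟨n1, _, _, hf.ab.1, rfl, rfl⟩,
          ⟨n1, _, _, hf.ab.2, rfl, rfl⟩⟩, ⟨⟨n2, _, _, hf.bc.1, rfl, rfl⟩,
          ⟨n2, _, _, hf.bc.2, rfl, rfl⟩⟩, ⟨⟨n3, _, _, hf.cd.1, rfl, rfl⟩,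
          ⟨n3, _, _, hf.cd.2, rfl, rfl⟩⟩, ⟨⟨n4, _, _, hf.da.1, rfl, rfl⟩,
          ⟨n4, _, _, hf.da.2, rfl, rfl⟩⟩, ?_, ?_⟩
        · rintro x y ⟨hne, x', y', hE, rfl, rfl⟩
          rcases hf.new x' y' hE with h1 | ⟨rfl, rfl⟩ | ⟨rfl, rfl⟩
          · exact Or.inl ⟨hne, x', y', h1, rfl, rfl⟩
          · exact Or.inr (Or.inl ⟨rfl, rfl⟩)
          · exact Or.inr (Or.inr ⟨rfl, rfl⟩)
        · rintro x y ⟨hne, x', y', hE, rfl, rfl⟩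
          rcases hf.old x' y' hE with h1 | ⟨rfl, rfl⟩ | ⟨rfl, rfl⟩
          · exact Or.inl ⟨hne, x', y', h1, rfl, rfl⟩
          · exact Or.inr (Or.inl ⟨rfl, rfl⟩)
          · exact Or.inr (Or.inr ⟨rfl, rfl⟩)
      · right
        have hcol := (hχ _ _ _ _ hf.cr).resolve_left hc
        have hbd : ∃ x y, G t x y ∧ χ x = χ (b t) ∧ χ y = χ (d t) := by
          rcases hcol with e | e | e | e
          · exact ⟨_, _, h.symm hf.da.1, e, rfl⟩
          · exact ⟨_, _, hf.cd.1, e.symm, rfl⟩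
          · exact ⟨_, _, hf.bc.1, rfl, e⟩
          · exact ⟨_, _, h.symm hf.ab.1, rfl, e.symm⟩
        have hac : ∃ x y, G (t + 1) x y ∧ χ x = χ (a t) ∧ χ y = χ (c t) := by
          rcases hcol with e | e | e | e
          · exact ⟨_, _, hf.bc.2, e.symm, rfl⟩
          · exact ⟨_, _, hf.ab.2, rfl, e⟩
          · exact ⟨_, _, h.symm hf.da.2, rfl, e.symm⟩
          · exact ⟨_, _, h.symm hf.cd.2, e, rfl⟩
        obtain ⟨u, v, huv, hu, hv⟩ := hbd
        obtain ⟨u', v', huv', hu', hv'⟩ := hac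
        funext x y
        apply propext
        constructor
        · rintro ⟨hne, x', y', hE, rfl, rfl⟩
          rcases hf.new x' y' hE with h1 | ⟨rfl, rfl⟩ | ⟨rfl, rfl⟩
          · exact ⟨hne, x', y', h1, rfl, rfl⟩
          · exact ⟨hne, u, v, huv, hu, hv⟩
          · exact ⟨hne, v, u, h.symm huv, hv, hu⟩
        · rintro ⟨hne, x', y', hE, rfl, rfl⟩
          rcases hf.old x' y' hE with h1 | ⟨rfl, rfl⟩ | ⟨rfl, rfl⟩
          · exact ⟨hne, x', y', h1, rfl, rfl⟩
          · exact ⟨hne, u', v', huv', hu', hv'⟩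
          · exact ⟨hne, v', u', h.symm huv', hv', hu'⟩
    · right
      simp only [heq]

/-! ### Counting flips around one vertex -/

open Classical in
/-- Flips that remove pairs at `v`, flips that insert pairs at `v` and flips that insert pairs at
vertices never related to `v` are all different. -/
theorem FlipPath.count {V l G a b c d J} (h : FlipPath V l G a b c d J) {v : ℕ} (hv : v ∈ V)
    {ι : Type*} (B : Finset ι) (f g : ι → ℕ) (hf : ∀ e ∈ B, f e ≠ v) (hg : ∀ e ∈ B, g e ≠ v)
    (hinj : ∀ e ∈ B, ∀ e' ∈ B, (f e = f e' ∧ g e = g e') ∨ (f e = g e' ∧ g e = f e') → e = e')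
    (h0 : ∀ e ∈ B, ¬ G 0 (f e) (g e)) (hl : ∀ e ∈ B, G l (f e) (g e)) :
    ∃ U ⊆ V.filter (fun x => x ≠ v ∧ ¬ G 0 v x), (V.filter (G 0 v)).card +
      2 * (V.filter (fun x => x ≠ v ∧ ¬ G 0 v x)).card +
      (B.filter fun e => f e ∈ U ∨ g e ∈ U).card ≤
        J.card + (V.filter (G l v)).card + 2 * U.card := by
  let N : ℕ → Finset ℕ := fun t => V.filter (G t v)
  have hN : ∀ t x, x ∈ N t ↔ G t v x := by
    intro t x
    simp only [N, Finset.mem_filter, and_iff_right_iff_imp]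
    exact fun hx => h.mem (h.symm hx)
  -- The times at which v loses a neighbour (R) and gains one (I). No flip does both, since v would
  -- be an end of both diagonals.
  let R := J.filter fun t => t < l ∧ ¬ N t ⊆ N (t + 1)
  let I := J.filter fun t => t < l ∧ ¬ N (t + 1) ⊆ N t
  have hrem : ∀ t < l, ¬ N t ⊆ N (t + 1) → t ∈ J ∧ (v = a t ∨ v = c t) ∧
      Flip (G t) (G (t + 1)) (a t) (b t) (c t) (d t) := by
    intro t ht hsub
    obtain ⟨x, hx, hx'⟩ := Finset.not_subset.1 hsub
    rw [hN] at hx hx'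
    rcases h.step t ht with ⟨hJ, hfl⟩ | heq
    · rcases hfl.old _ _ hx with h1 | h1 | h1
      · exact absurd h1 hx'
      · exact ⟨hJ, Or.inl h1.1, hfl⟩
      · exact ⟨hJ, Or.inr h1.1, hfl⟩
    · rw [heq] at hx'
      exact absurd hx hx'
  have hins : ∀ t < l, ¬ N (t + 1) ⊆ N t → t ∈ J ∧ (v = b t ∨ v = d t) ∧
      Flip (G t) (G (t + 1)) (a t) (b t) (c t) (d t) := by
    intro t ht hsub
    obtain ⟨x, hx, hx'⟩ := Finset.not_subset.1 hsub
    rw [hN] at hx hx'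
    rcases h.step t ht with ⟨hJ, hfl⟩ | heq
    · rcases hfl.new _ _ hx with h1 | h1 | h1
      · exact absurd h1 hx'
      · exact ⟨hJ, Or.inl h1.1, hfl⟩
      · exact ⟨hJ, Or.inr h1.1, hfl⟩
    · rw [heq] at hx
      exact absurd hx hx'
  have hexcl : ∀ t < l, ¬ N t ⊆ N (t + 1) → N (t + 1) ⊆ N t := by
    intro t ht h1
    by_contra h2
    obtain ⟨-, h3, hfl⟩ := hrem t ht h1
    obtain ⟨-, h4, -⟩ := hins t ht h2
    obtain ⟨n1, n2, n3, n4, -, -⟩ := hfl.cr.pairwise_ne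
    omega
  have hcardrem : ∀ t < l, ¬ N t ⊆ N (t + 1) → (N t).card ≤ (N (t + 1)).card + 1 := by
    intro t ht h1
    obtain ⟨-, h3, hfl⟩ := hrem t ht h1
    obtain ⟨w, hw⟩ : ∃ w, N t ⊆ insert w (N (t + 1)) := by
      rcases h3 with h3 | h3
      · refine ⟨c t, fun x hx => ?_⟩
        rw [Finset.mem_insert, hN]
        rw [hN] at hx
        have := hfl.cr.pairwise_ne
        rcases hfl.old _ _ hx with h4 | h4 | h4
        · exact Or.inr h4
        · exact Or.inl h4.2
        · omega
      · refine ⟨a t, fun x hx => ?_⟩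
        rw [Finset.mem_insert, hN]
        rw [hN] at hx
        have := hfl.cr.pairwise_ne
        rcases hfl.old _ _ hx with h4 | h4 | h4
        · exact Or.inr h4
        · omega
        · exact Or.inl h4.2
    exact (Finset.card_le_card hw).trans (Finset.card_insert_le _ _)
  have hsubins : ∀ t < l, ¬ N (t + 1) ⊆ N t → ∃ w, N (t + 1) ⊆ insert w (N t) := by
    intro t ht h1
    obtain ⟨-, h3, hfl⟩ := hins t ht h1
    rcases h3 with h3 | h3
    · refine ⟨d t, fun x hx => ?_⟩
      rw [Finset.mem_insert, hN]
      rw [hN] at hx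
      have := hfl.cr.pairwise_ne
      rcases hfl.new _ _ hx with h4 | h4 | h4
      · exact Or.inr h4
      · exact Or.inl h4.2
      · omega
    · refine ⟨b t, fun x hx => ?_⟩
      rw [Finset.mem_insert, hN]
      rw [hN] at hx
      have := hfl.cr.pairwise_ne
      rcases hfl.new _ _ hx with h4 | h4 | h4
      · exact Or.inr h4
      · omega
      · exact Or.inl h4.2
  have hfilt : ∀ (A : Finset ℕ) k, (A.filter (· < k + 1)).card =
      (A.filter (· < k)).card + if k ∈ A then 1 else 0 := by
    intro A k
    have h1 : A.filter (· < k + 1) = A.filter (· < k) ∪ A.filter (· = k) := by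
      ext x
      simp only [Finset.mem_filter, Finset.mem_union]
      constructor
      · rintro ⟨h1, h2⟩
        rcases Nat.lt_succ_iff_lt_or_eq.1 h2 with h3 | h3
        · exact Or.inl ⟨h1, h3⟩
        · exact Or.inr ⟨h1, h3⟩
      · rintro (⟨h1, h2⟩ | ⟨h1, h2⟩)
        · exact ⟨h1, by omega⟩
        · exact ⟨h1, by omega⟩
    rw [h1, Finset.card_union_of_disjoint]
    · congr 1
      rw [Finset.filter_eq']
      split_ifs <;> simp
    · rw [Finset.disjoint_left]
      intro x hx hx'
      simp only [Finset.mem_filter] at hx hx'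
      omega
  have hbal : ∀ k ≤ l, (N 0).card + (I.filter (· < k)).card ≤
      (N k).card + (R.filter (· < k)).card := by
    intro k
    induction k with
    | zero => intro _; simp
    | succ k ih =>
      intro hk
      have ih' := ih (by omega)
      rw [hfilt, hfilt]
      by_cases h1 : N k ⊆ N (k + 1)
      · by_cases h2 : N (k + 1) ⊆ N k
        · have e : N k = N (k + 1) := Finset.Subset.antisymm h1 h2
          rw [if_neg (fun hk => (Finset.mem_filter.1 hk).2.2 h2), ← e]
          omega
        · have := Finset.card_lt_card (Finset.ssubset_def.2 ⟨h1, h2⟩)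
          split_ifs <;> omega
      · have h2 := hexcl k (by omega) h1
        have h3 := hcardrem k (by omega) h1
        rw [if_neg (fun hk => (Finset.mem_filter.1 hk).2.2 h2),
          if_pos (Finset.mem_filter.2 ⟨(hrem k (by omega) h1).1, by omega, h1⟩)]
        omega
  -- Each insertion at v adds at most one vertex to the set of all neighbours seen so far.
  have hvis : ∀ k ≤ l, ((Finset.range (k + 1)).biUnion N).card ≤
      (N 0).card + (I.filter (· < k)).card := by
    intro k
    induction k with
    | zero => intro _; simp
    | succ k ih =>
      intro hk
      have ih' := ih (by omega)
      rw [hfilt, Finset.range_add_one, Finset.biUnion_insert]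
      have hsub : N k ⊆ (Finset.range (k + 1)).biUnion N :=
        Finset.subset_biUnion_of_mem N (by simp)
      by_cases h2 : N (k + 1) ⊆ N k
      · rw [Finset.union_eq_right.2 (h2.trans hsub)]
        omega
      · obtain ⟨w, hw⟩ := hsubins k (by omega) h2
        rw [if_pos (Finset.mem_filter.2 ⟨(hins k (by omega) h2).1, by omega, h2⟩)]
        have h3 : N (k + 1) ∪ (Finset.range (k + 1)).biUnion N ⊆
            insert w ((Finset.range (k + 1)).biUnion N) :=
          Finset.union_subset (hw.trans (Finset.insert_subset_insert _ hsub))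
            (Finset.subset_insert _ _)
        have h4 := (Finset.card_le_card h3).trans (Finset.card_insert_le _ _)
        omega
  set A := (Finset.range (l + 1)).biUnion N with hA
  have hAN : ∀ t ≤ l, ∀ x, G t v x → x ∈ A := by
    intro t ht x hx
    rw [hA, Finset.mem_biUnion]
    exact ⟨t, by simp; omega, (hN t x).2 hx⟩
  set K := V.filter (fun x => x ≠ v ∧ ¬ G 0 v x) with hK
  -- U consists of the vertices that are never joined to v.
  refine ⟨(V.erase v) \ A, ?_, ?_⟩
  · intro x hx
    rw [Finset.mem_sdiff, Finset.mem_erase] at hx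
    rw [hK, Finset.mem_filter]
    exact ⟨hx.1.2, hx.1.1, fun h1 => hx.2 (hAN 0 (Nat.zero_le _) x h1)⟩
  set U := (V.erase v) \ A with hU
  have hIl : I.filter (· < l) = I :=
    Finset.filter_true_of_mem fun t ht => (Finset.mem_filter.1 ht).2.1
  have hRl : R.filter (· < l) = R :=
    Finset.filter_true_of_mem fun t ht => (Finset.mem_filter.1 ht).2.1
  have hb := hbal l le_rfl
  have hvs := hvis l le_rfl
  rw [hIl] at hb hvs
  rw [hRl] at hb
  rw [← hA] at hvs
  have hVcard : V.card = (N 0).card + K.card + 1 := by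
    rw [← Finset.card_erase_add_one hv]
    congr 1
    rw [← Finset.card_union_of_disjoint]
    · congr 1
      ext x
      simp only [Finset.mem_erase, Finset.mem_union, hN, hK, Finset.mem_filter]
      constructor
      · rintro ⟨h1, h2⟩
        by_cases h3 : G 0 v x
        · exact Or.inl h3
        · exact Or.inr ⟨h2, h1, h3⟩
      · rintro (h1 | h1)
        · exact ⟨(h.ne h1).symm, h.mem (h.symm h1)⟩
        · exact ⟨h1.2.1, h1.1⟩
    · rw [Finset.disjoint_left]
      intro x hx hx'
      rw [hN] at hx
      exact (Finset.mem_filter.1 hx').2.2 hx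
  have hUcard : V.card ≤ U.card + A.card + 1 := by
    rw [← Finset.card_erase_add_one hv]
    have := Finset.card_le_card_sdiff_add_card (s := V.erase v) (t := A)
    rw [← hU] at this
    omega
  have hcount : R.card + I.card + (B.filter fun e => f e ∈ U ∨ g e ∈ U).card ≤ J.card := by
    have htime : ∀ e : ι, ∃ t, e ∈ B → t < l ∧ ¬ G t (f e) (g e) ∧ G (t + 1) (f e) (g e) := by
      intro e
      by_cases he : e ∈ B
      · by_contra hcon
        push Not at hcon
        have : ∀ k ≤ l, ¬ G k (f e) (g e) := by
          intro k
          induction k with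
          | zero => intro _; exact h0 e he
          | succ k ih =>
            intro hk
            exact (hcon k).2 (by omega) (ih (by omega))
        exact this l le_rfl (hl e he)
      · exact ⟨0, fun h => absurd h he⟩
    choose τ hτ using htime
    have hflip : ∀ e ∈ B, τ e ∈ J ∧ Flip (G (τ e)) (G (τ e + 1)) (a (τ e)) (b (τ e)) (c (τ e))
        (d (τ e)) ∧ ((f e = b (τ e) ∧ g e = d (τ e)) ∨ (f e = d (τ e) ∧ g e = b (τ e))) := by
      intro e he
      obtain ⟨h1, h2, h3⟩ := hτ e he
      rcases h.step _ h1 with ⟨hJ, hfl⟩ | heq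
      · rcases hfl.new _ _ h3 with h4 | h4
        · exact absurd h4 h2
        · exact ⟨hJ, hfl, h4⟩
      · rw [heq] at h3
        exact absurd h3 h2
    have hRI : Disjoint R I := by
      rw [Finset.disjoint_left]
      intro t h1 h2
      rw [Finset.mem_filter] at h1 h2
      exact h2.2.2 (hexcl t h1.2.1 h1.2.2)
    have hsub : R ∪ I ⊆ J := Finset.union_subset (Finset.filter_subset _ _)
      (Finset.filter_subset _ _)
    have hle : (B.filter fun e => f e ∈ U ∨ g e ∈ U).card ≤ (J \ (R ∪ I)).card := by
      apply Finset.card_le_card_of_injOn τ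
      · intro e he
        rw [Finset.mem_coe, Finset.mem_filter] at he
        obtain ⟨heB, heU⟩ := he
        obtain ⟨hJ, hfl, hbd⟩ := hflip e heB
        have hlt := (hτ e heB).1
        rw [Finset.mem_coe, Finset.mem_sdiff]
        -- A flip removing an edge at v inserts a pair of neighbours of v, both in A and so not in
        -- U. A flip inserting an edge at v inserts a pair containing v, which no element of B does.
        refine ⟨hJ, fun hRI => ?_⟩
        rcases Finset.mem_union.1 hRI with hR | hI
        · rw [Finset.mem_filter] at hR
          obtain ⟨-, hv', -⟩ := hrem _ hlt hR.2.2
          have hbA : b (τ e) ∈ A := by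
            rcases hv' with hv' | hv'
            · exact hAN _ hlt.le _ (hv' ▸ hfl.ab.1)
            · exact hAN _ hlt.le _ (hv' ▸ h.symm hfl.bc.1)
          have hdA : d (τ e) ∈ A := by
            rcases hv' with hv' | hv'
            · exact hAN _ hlt.le _ (hv' ▸ h.symm hfl.da.1)
            · exact hAN _ hlt.le _ (hv' ▸ hfl.cd.1)
          rw [hU, Finset.mem_sdiff, Finset.mem_sdiff] at heU
          rcases hbd with ⟨h1, h2⟩ | ⟨h1, h2⟩
          · rw [h1, h2] at heU
            rcases heU with h3 | h3
            · exact h3.2 hbA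
            · exact h3.2 hdA
          · rw [h1, h2] at heU
            rcases heU with h3 | h3
            · exact h3.2 hdA
            · exact h3.2 hbA
        · rw [Finset.mem_filter] at hI
          obtain ⟨-, hv', -⟩ := hins _ hlt hI.2.2
          have h1 := hf e heB
          have h2 := hg e heB
          omega
      · intro e he e' he' heq
        rw [Finset.mem_coe, Finset.mem_filter] at he he'
        obtain ⟨-, -, h1⟩ := hflip e he.1
        obtain ⟨-, -, h2⟩ := hflip e' he'.1
        rw [heq] at h1
        exact hinj e he.1 e' he'.1 (by omega)
    have h1 := Finset.card_sdiff_add_card_eq_card hsub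
    rw [Finset.card_union_of_disjoint hRI] at h1
    omega
  change (N 0).card + 2 * K.card + _ ≤ J.card + (N l).card + 2 * U.card
  omega

/-- The relabelling ρ moves all labels into [v, v + n), so that v comes first and a pair crosses v x
exactly when it encloses ρ x. -/
theorem cr_rotate_iff {n v x r s : ℕ} (hx : x < n) (hr : r < n) (hs : s < n)
    (hrv : r ≠ v) (hsv : s ≠ v) {ρ : ℕ → ℕ}
    (hρ : ∀ x, ρ x = if x < v then x + n else x) :
    Cr v x r s ↔ (ρ r < ρ x ∧ ρ x < ρ s) ∨ (ρ s < ρ x ∧ ρ x < ρ r) := by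
  rw [hρ, hρ, hρ]
  unfold Cr
  split_ifs <;> omega

theorem cr_rotate {n v p q r s : ℕ} (hp : p < n) (hq : q < n) (hr : r < n) (hs : s < n) {ρ : ℕ → ℕ}
    (hρ : ∀ x, ρ x = if x < v then x + n else x) (h : Cr p q r s) :
    Cr (ρ p) (ρ q) (ρ r) (ρ s) := by
  rw [hρ, hρ, hρ, hρ]
  unfold Cr at *
  split_ifs <;> omega

open Classical in
/-- A triangulation `L` with a vertex `v` of full degree at least `q + 3` and at least `q`
non-neighbours is at least `|V| - 3 + q` flips away from some non-crossing relation. -/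
theorem Tri.exists_far {V L} (hL : Tri V L) {v : ℕ} (hv : v ∈ V) {q : ℕ}
    (hq1 : q + (V.filter (L v)).card + 1 ≤ V.card) (hq2 : q + 3 ≤ (V.filter (L v)).card) :
    ∃ D, NC V D ∧ ∀ F, NC V F → (∀ x y, D x y → F x y) → ∀ l G a b c d J,
      FlipPath V l G a b c d J → G 0 = L → G l = F → V.card + q ≤ J.card + 3 := by
  obtain ⟨n, hn⟩ : ∃ n, ∀ x ∈ V, x < n := ⟨V.sup id + 1, fun x hx =>
    Nat.lt_succ_of_le (Finset.le_sup (f := id) hx)⟩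
  obtain ⟨ρ, hρ⟩ : ∃ ρ : ℕ → ℕ, ∀ x, ρ x = if x < v then x + n else x := ⟨_, fun _ => rfl⟩
  obtain ⟨σ, hσ⟩ : ∃ σ : ℕ → ℕ, ∀ x, σ x = if n ≤ x then x - n else x := ⟨_, fun _ => rfl⟩
  have hσρ : ∀ x ∈ V, σ (ρ x) = x := by
    intro x hx
    have := hn x hx
    rw [hσ, hρ]
    split_ifs <;> omega
  have hinjρ : Set.InjOn ρ V := fun x hx y hy h => by rw [← hσρ x hx, ← hσρ y hy, h]
  set K := V.filter (fun x => x ≠ v ∧ ¬ L v x) with hK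
  set S := V.filter (L v) with hS
  have hVcard : V.card = S.card + K.card + 1 := by
    rw [← Finset.card_erase_add_one hv]
    congr 1
    rw [← Finset.card_union_of_disjoint]
    · congr 1
      ext x
      simp only [Finset.mem_erase, Finset.mem_union, hS, hK, Finset.mem_filter]
      constructor
      · rintro ⟨h1, h2⟩
        by_cases h3 : L v x
        · exact Or.inl ⟨h2, h3⟩
        · exact Or.inr ⟨h2, h1, h3⟩
      · rintro (h1 | h1)
        · exact ⟨(hL.ne h1.2).symm, h1.1⟩
        · exact ⟨h1.2.1, h1.1⟩
    · rw [Finset.disjoint_left]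
      intro x hx hx'
      exact (Finset.mem_filter.1 hx').2.2 (Finset.mem_filter.1 hx).2
  obtain ⟨K₀, hK₀, hK₀c⟩ := Finset.exists_subset_card_eq (s := K) (n := q) (by omega)
  set Q := (V.erase v).image ρ with hQ
  have hmemQ : ∀ y, y ∈ Q ↔ ∃ x ∈ V, x ≠ v ∧ ρ x = y := by
    intro y
    rw [hQ, Finset.mem_image]
    constructor
    · rintro ⟨x, hx, rfl⟩
      rw [Finset.mem_erase] at hx
      exact ⟨x, hx.2, hx.1, rfl⟩
    · rintro ⟨x, hx, hxv, rfl⟩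
      exact ⟨x, Finset.mem_erase.2 ⟨hxv, hx⟩, rfl⟩
  -- Demand one for each non-neighbour of v and one more for q of them. The total |K| + q is at most
  -- |Q| - 3 precisely because q + 3 is at most the degree of v.
  let δ₀ : ℕ → ℕ := fun x => (if x ∈ K then 1 else 0) + if x ∈ K₀ then 1 else 0
  have hsumδ : ∀ A ⊆ V, ∑ y ∈ A.image ρ, δ₀ (σ y) = (A ∩ K).card + (A ∩ K₀).card := by
    intro A hA
    rw [Finset.sum_image (hinjρ.mono hA), Finset.sum_congr rfl (g := δ₀) fun x hx => by
      rw [hσρ x (hA hx)]]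
    simp only [δ₀, Finset.sum_add_distrib, Finset.sum_ite_mem, Finset.sum_const, smul_eq_mul,
      mul_one]
  have hQcard : Q.card + 1 = V.card := by
    rw [hQ, Finset.card_image_of_injOn (hinjρ.mono (by
      rw [Finset.coe_subset]; exact Finset.erase_subset _ _)), Finset.card_erase_add_one hv]
  have hKv : K ⊆ V.erase v := by
    intro x hx
    rw [hK, Finset.mem_filter] at hx
    exact Finset.mem_erase.2 ⟨hx.2.1, hx.1⟩
  have hsum : ∑ y ∈ Q, δ₀ (σ y) + 3 ≤ Q.card := by
    rw [hQ, hsumδ _ (Finset.erase_subset _ _), ← hQ, Finset.inter_eq_right.2 hKv,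
      Finset.inter_eq_right.2 (hK₀.trans hKv)]
    omega
  have hin : ∀ y ∈ Q, 0 < δ₀ (σ y) → (∃ y' ∈ Q, y' < y) ∧ ∃ y' ∈ Q, y < y' := by
    intro y hy hpos
    obtain ⟨x, hx, hxv, rfl⟩ := (hmemQ y).1 hy
    rw [hσρ x hx] at hpos
    have hxK : x ∈ K := by
      by_contra h
      have h' : x ∉ K₀ := fun h1 => h (hK₀ h1)
      simp [δ₀, h, h'] at hpos
    have hnL := (Finset.mem_filter.1 hxK).2.2
    -- A non-neighbour x is not extreme: some edge of L crosses v x, and its ends lie on both sides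
    -- of x.
    have : ¬ ∀ r s, L r s → ¬ Cr v x r s := fun h1 => hnL (hL.max hv hx hxv.symm h1)
    push Not at this
    obtain ⟨r, s, hrs, hcr⟩ := this
    have hrv : r ≠ v := by rintro rfl; unfold Cr at hcr; omega
    have hsv : s ≠ v := by rintro rfl; unfold Cr at hcr; omega
    have hr := hL.mem hrs
    have hs := hL.mem_right hrs
    rw [cr_rotate_iff (hn x hx) (hn r hr) (hn s hs) hrv hsv hρ] at hcr
    have hrQ := (hmemQ (ρ r)).2 ⟨r, hr, hrv, rfl⟩
    have hsQ := (hmemQ (ρ s)).2 ⟨s, hs, hsv, rfl⟩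
    rcases hcr with h1 | h1
    · exact ⟨⟨_, hrQ, h1.1⟩, _, hsQ, h1.2⟩
    · exact ⟨⟨_, hsQ, h1.1⟩, _, hrQ, h1.2⟩
  obtain ⟨B, hB1, hB2, hB3⟩ := exists_diagonals (fun s => ∃ x ∈ V, ρ x = s ∧ L v x) Q
    (fun y => δ₀ (σ y)) hin hsum (by
      intro p hp y hy w hw hpy hyw h0
      obtain ⟨x, hx, hxv, rfl⟩ := (hmemQ y).1 hy
      rw [hσρ x hx] at h0
      -- A point of demand zero is itself a neighbour of v and serves as the separating point.
      refine ⟨ρ x, ⟨x, hx, rfl, ?_⟩, hpy, hyw⟩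
      by_contra h1
      have : x ∈ K := Finset.mem_filter.2 ⟨hx, hxv, h1⟩
      simp [δ₀, this] at h0)
  have hQne : Q.Nonempty := Finset.card_pos.1 (by omega)
  obtain ⟨m, hm, hmin⟩ := Q.exists_min_image id hQne
  obtain ⟨M, hM, hmax⟩ := Q.exists_max_image id hQne
  simp only [id] at hmin hmax
  have hmM : m < M := by
    refine lt_of_le_of_ne (hmin M hM) fun h1 => ?_
    have : Q ⊆ {m} := by
      intro y hy
      have h2 := hmin y hy
      have h3 := hmax y hy
      rw [Finset.mem_singleton]
      omega
    have := Finset.card_le_card this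
    rw [Finset.card_singleton] at this
    omega
  -- The pair of extreme points m M cuts v off as an ear, so v keeps at most two neighbours in the
  -- target.
  let D₀ : ℕ → ℕ → Prop := fun u w => (u, w) ∈ B ∨ (u = m ∧ w = M)
  have hD₀ : ∀ u w, D₀ u w → u ∈ Q ∧ w ∈ Q ∧ u < w := by
    rintro u w (h1 | ⟨rfl, rfl⟩)
    · obtain ⟨h2, h3, ⟨x, -, h4⟩, -⟩ := hB1 _ h1
      exact ⟨h2, h3, h4.1.trans h4.2⟩
    · exact ⟨hm, hM, hmM⟩
  have hD₀nc : ∀ u w u' w', D₀ u w → D₀ u' w' → ¬ (u < u' ∧ u' < w ∧ w < w') := by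
    rintro u w u' w' h1 h2
    have h3 := hD₀ _ _ h1
    have h4 := hD₀ _ _ h2
    have h5 := hmin _ h3.1
    have h6 := hmin _ h4.1
    have h7 := hmax _ h3.2.1
    have h8 := hmax _ h4.2.1
    rcases h1 with h1 | ⟨rfl, rfl⟩
    · rcases h2 with h2 | ⟨rfl, rfl⟩
      · exact hB2 _ h1 _ h2
      · omega
    · omega
  let D : ℕ → ℕ → Prop := fun x y => x ∈ V ∧ y ∈ V ∧ x ≠ v ∧ y ≠ v ∧ (D₀ (ρ x) (ρ y) ∨ D₀ (ρ y) (ρ x))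
  have hDNC : NC V D := by
    refine ⟨?_, ?_, ?_, ?_⟩
    · rintro x y ⟨h1, h2, h3, h4, h5⟩
      exact ⟨h2, h1, h4, h3, h5.symm⟩
    · exact fun h => h.1
    · rintro x y ⟨h1, h2, h3, h4, h5⟩ rfl
      rcases h5 with h5 | h5
      · exact absurd (hD₀ _ _ h5).2.2 (lt_irrefl _)
      · exact absurd (hD₀ _ _ h5).2.2 (lt_irrefl _)
    · rintro x y r s ⟨h1, h2, -, -, h5⟩ ⟨h1', h2', -, -, h5'⟩ hcr
      have h6 := cr_rotate (hn _ h1) (hn _ h2) (hn _ h1') (hn _ h2') hρ hcr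
      rcases h5 with h5 | h5 <;> rcases h5' with h7 | h7
      · have a1 := hD₀nc _ _ _ _ h5 h7
        have a2 := hD₀nc _ _ _ _ h7 h5
        rw [cr_iff (hD₀ _ _ h5).2.2 (hD₀ _ _ h7).2.2] at h6
        omega
      · have a1 := hD₀nc _ _ _ _ h5 h7
        have a2 := hD₀nc _ _ _ _ h7 h5
        rw [cr_swap_right, cr_iff (hD₀ _ _ h5).2.2 (hD₀ _ _ h7).2.2] at h6
        omega
      · have a1 := hD₀nc _ _ _ _ h5 h7
        have a2 := hD₀nc _ _ _ _ h7 h5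
        rw [cr_swap_left, cr_iff (hD₀ _ _ h5).2.2 (hD₀ _ _ h7).2.2] at h6
        omega
      · have a1 := hD₀nc _ _ _ _ h5 h7
        have a2 := hD₀nc _ _ _ _ h7 h5
        rw [cr_swap_left, cr_swap_right, cr_iff (hD₀ _ _ h5).2.2 (hD₀ _ _ h7).2.2] at h6
        omega
  have hρσ : ∀ y ∈ Q, σ y ∈ V ∧ σ y ≠ v ∧ ρ (σ y) = y := by
    intro y hy
    obtain ⟨x, hx, hxv, rfl⟩ := (hmemQ y).1 hy
    rw [hσρ x hx]
    exact ⟨hx, hxv, rfl⟩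
  have hDB : ∀ u w, D₀ u w → D (σ u) (σ w) := by
    intro u w huw
    obtain ⟨hu, hw, -⟩ := hD₀ _ _ huw
    obtain ⟨h1, h2, h3⟩ := hρσ u hu
    obtain ⟨h4, h5, h6⟩ := hρσ w hw
    exact ⟨h1, h4, h2, h5, Or.inl (by rwa [h3, h6])⟩
  refine ⟨D, hDNC, fun F hF hDF l G a b c d J hpath hG0 hGl => ?_⟩
  have hmM' := hDF _ _ (hDB _ _ (Or.inr ⟨rfl, rfl⟩))
  have hSl : (V.filter (G l v)).card ≤ 2 := by
    have : V.filter (G l v) ⊆ {σ m, σ M} := by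
      intro x hx
      rw [Finset.mem_filter, hGl] at hx
      by_contra hne
      simp only [Finset.mem_insert, Finset.mem_singleton, not_or] at hne
      have hxv := (hF.ne hx.2).symm
      obtain ⟨h1, h2, h3⟩ := hρσ m hm
      obtain ⟨h4, h5, h6⟩ := hρσ M hM
      have hxQ := (hmemQ (ρ x)).2 ⟨x, hx.1, hxv, rfl⟩
      refine hF.nc hx.2 hmM' ((cr_rotate_iff (hn x hx.1) (hn _ h1) (hn _ h4) h2 h5 hρ).2
        (Or.inl ?_))
      rw [h3, h6]
      have e1 := hmin _ hxQ
      have e2 := hmax _ hxQ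
      have e3 : ρ x ≠ m := fun h => hne.1 (by rw [← h, hσρ x hx.1])
      have e4 : ρ x ≠ M := fun h => hne.2 (by rw [← h, hσρ x hx.1])
      omega
    exact (Finset.card_le_card this).trans Finset.card_le_two
  obtain ⟨U, hU, hcount⟩ := hpath.count hv B (fun e => σ e.1) (fun e => σ e.2)
    (fun e he => (hρσ _ (hB1 e he).1).2.1) (fun e he => (hρσ _ (hB1 e he).2.1).2.1)
    (by
      intro e he e' he' heq
      have h1 := (hρσ _ (hB1 e he).1).2.2
      have h2 := (hρσ _ (hB1 e he).2.1).2.2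
      have h3 := (hρσ _ (hB1 e' he').1).2.2
      have h4 := (hρσ _ (hB1 e' he').2.1).2.2
      have h5 := (hD₀ e.1 e.2 (Or.inl he)).2.2
      have h6 := (hD₀ e'.1 e'.2 (Or.inl he')).2.2
      rcases heq with ⟨e1, e2⟩ | ⟨e1, e2⟩
      · rw [e1] at h1
        rw [e2] at h2
        exact Prod.ext (h1.symm.trans h3) (h2.symm.trans h4)
      · rw [e1] at h1
        rw [e2] at h2
        omega)
    (by
      intro e he hLe
      rw [hG0] at hLe
      obtain ⟨h1, h2, -, s, ⟨x, hx, rfl, hLx⟩, h3, h4⟩ := hB1 e he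
      obtain ⟨g1, g2, g3⟩ := hρσ _ h1
      obtain ⟨g4, g5, g6⟩ := hρσ _ h2
      refine hL.nc hLx hLe ((cr_rotate_iff (hn x hx) (hn _ g1) (hn _ g4)
        g2 g5 hρ).2 (Or.inl ?_))
      rw [g3, g6]
      exact ⟨h3, h4⟩)
    (by
      intro e he
      rw [hGl]
      exact hDF _ _ (hDB _ _ (Or.inl he)))
  rw [hG0, ← hK, ← hS] at hcount
  rw [hG0, ← hK] at hU
  have hUV : U ⊆ V := hU.trans (Finset.filter_subset _ _)
  have hUv : U ⊆ V.erase v := hU.trans hKv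
  have h1 := hB3 (U.image ρ)
  have h2 : Q.filter (· ∈ U.image ρ) = U.image ρ := by
    ext y
    rw [Finset.mem_filter]
    refine ⟨fun h => h.2, fun h => ⟨?_, h⟩⟩
    exact Finset.image_subset_image hUv h
  rw [h2, hsumδ U hUV, Finset.inter_eq_left.2 hU] at h1
  have h3 : (B.filter fun e => e.1 ∈ U.image ρ ∨ e.2 ∈ U.image ρ).card ≤
      (B.filter fun e => σ e.1 ∈ U ∨ σ e.2 ∈ U).card := by
    apply Finset.card_le_card
    intro e he
    rw [Finset.mem_filter] at he ⊢
    refine ⟨he.1, he.2.imp ?_ ?_⟩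
    · intro h
      obtain ⟨x, hx, hxe⟩ := Finset.mem_image.1 h
      rw [← hxe, hσρ x (hUV hx)]
      exact hx
    · intro h
      obtain ⟨x, hx, hxe⟩ := Finset.mem_image.1 h
      rw [← hxe, hσρ x (hUV hx)]
      exact hx
  -- The flips counted so far number at least |S| - 2 + 2|K| - |U \ K₀|, and |U \ K₀| ≤ |K| - q.
  have h4 : K₀.card + U.card ≤ (U ∩ K₀).card + K.card := by
    have e1 := Finset.card_union_add_card_inter U K₀
    have e2 := Finset.card_le_card (Finset.union_subset hU hK₀)
    omega
  omega

/-! ### Contracting one side of an edge -/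

/-- The corners of a crossing quadrilateral are increasing up to rotation and reversal, so symmetric
statements need only be checked in one order. -/
theorem Cr.sorted {P : ℕ → ℕ → ℕ → ℕ → Prop} (hrot : ∀ a b c d, P a b c d → P b c d a)
    (hrev : ∀ a b c d, P a b c d → P d c b a)
    (hP : ∀ a b c d, a < b → b < c → c < d → P a b c d) {a b c d : ℕ} (h : Cr a c b d) :
    P a b c d := by
  rcases h with ⟨h1 | h1, h2 | h2⟩ | ⟨h1 | h1, h2 | h2⟩
  · exact hrot _ _ _ _ (hP _ _ _ _ h2.1 h1.1 h1.2)
  · exact hP _ _ _ _ h1.1 h1.2 h2.2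
  · exact hrev _ _ _ _ (hP _ _ _ _ h2.2 h1.1 h1.2)
  · exact hrot _ _ _ _ (hrev _ _ _ _ (hP _ _ _ _ h1.1 h1.2 h2.1))
  · exact hrot _ _ _ _ (hrot _ _ _ _ (hrev _ _ _ _ (hP _ _ _ _ h2.1 h1.1 h1.2)))
  · exact hrot _ _ _ _ (hrot _ _ _ _ (hrot _ _ _ _ (hrev _ _ _ _ (hP _ _ _ _ h1.1 h1.2 h2.2))))
  · exact hrot _ _ _ _ (hrot _ _ _ _ (hrot _ _ _ _ (hP _ _ _ _ h2.2 h1.1 h1.2)))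
  · exact hrot _ _ _ _ (hrot _ _ _ _ (hP _ _ _ _ h1.1 h1.2 h2.1))

theorem cr_rot {a b c d : ℕ} : Cr a c b d ↔ Cr b d c a := by
  rw [cr_comm, cr_swap_right]

theorem cr_rev {a b c d : ℕ} : Cr a c b d ↔ Cr d b c a := by
  rw [cr_comm, cr_swap_left, cr_swap_right]

theorem collapsing_of_sorted {χ : ℕ → ℕ} (h : ∀ a b c d, a < b → b < c → c < d →
    Cr (χ a) (χ c) (χ b) (χ d) ∨ χ a = χ b ∨ χ b = χ c ∨ χ c = χ d ∨ χ d = χ a) :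
    Collapsing χ := by
  intro a b c d hcr
  refine Cr.sorted (P := fun a b c d => Cr (χ a) (χ c) (χ b) (χ d) ∨ χ a = χ b ∨ χ b = χ c ∨
    χ c = χ d ∨ χ d = χ a) ?_ ?_ h hcr
  · rintro a b c d (h1 | h1 | h1 | h1 | h1)
    · exact Or.inl (cr_rot.1 h1)
    all_goals simp [h1]
  · rintro a b c d (h1 | h1 | h1 | h1 | h1)
    · exact Or.inl (cr_rev.1 h1)
    all_goals simp [h1]

/-- Contraction of the vertices between `a` and `c` to `a`. -/
def below (a c x : ℕ) : ℕ := if a < x ∧ x < c then a else x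

/-- Contraction of the vertices outside the interval from `a` to `c` to `z`. -/
def above (a c z x : ℕ) : ℕ := if a ≤ x ∧ x ≤ c then x else z

theorem below_cases (a c x : ℕ) :
    (a < x ∧ x < c ∧ below a c x = a) ∨ ((x ≤ a ∨ c ≤ x) ∧ below a c x = x) := by
  unfold below
  split_ifs <;> omega

theorem above_cases (a c z x : ℕ) :
    (a ≤ x ∧ x ≤ c ∧ above a c z x = x) ∨ ((x < a ∨ c < x) ∧ above a c z x = z) := by
  unfold above
  split_ifs <;> omega

theorem below_mono (a c : ℕ) : Monotone (below a c) := by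
  intro x y hxy
  rcases below_cases a c x with h | h <;> rcases below_cases a c y with h' | h' <;> omega

theorem collapsing_below (a c : ℕ) : Collapsing (below a c) := by
  refine collapsing_of_sorted fun p q r s h1 h2 h3 => ?_
  have e1 := below_mono a c h1.le
  have e2 := below_mono a c h2.le
  have e3 := below_mono a c h3.le
  by_cases g1 : below a c p = below a c q
  · simp [g1]
  by_cases g2 : below a c q = below a c r
  · simp [g2]
  by_cases g3 : below a c r = below a c s
  · simp [g3]
  left
  rw [cr_iff (by omega) (by omega)]
  omega

/-- A monotone map reflects strict inequalities, hence crossings. This keeps images of non-crossing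
relations non-crossing, whereas `Collapsing` is what flips require. -/
theorem below_reflect {a c p q r s : ℕ}
    (h : Cr (below a c p) (below a c q) (below a c r) (below a c s)) : Cr p q r s := by
  have hm : ∀ {x y}, below a c x < below a c y → x < y := fun h => (below_mono a c).reflect_lt h
  rcases h with ⟨h1 | h1, h2 | h2⟩ | ⟨h1 | h1, h2 | h2⟩
  · exact Or.inl ⟨Or.inl ⟨hm h1.1, hm h1.2⟩, Or.inl ⟨hm h2.1, hm h2.2⟩⟩
  · exact Or.inl ⟨Or.inl ⟨hm h1.1, hm h1.2⟩, Or.inr ⟨hm h2.1, hm h2.2⟩⟩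
  · exact Or.inl ⟨Or.inr ⟨hm h1.1, hm h1.2⟩, Or.inl ⟨hm h2.1, hm h2.2⟩⟩
  · exact Or.inl ⟨Or.inr ⟨hm h1.1, hm h1.2⟩, Or.inr ⟨hm h2.1, hm h2.2⟩⟩
  · exact Or.inr ⟨Or.inl ⟨hm h1.1, hm h1.2⟩, Or.inl ⟨hm h2.1, hm h2.2⟩⟩
  · exact Or.inr ⟨Or.inl ⟨hm h1.1, hm h1.2⟩, Or.inr ⟨hm h2.1, hm h2.2⟩⟩
  · exact Or.inr ⟨Or.inr ⟨hm h1.1, hm h1.2⟩, Or.inl ⟨hm h2.1, hm h2.2⟩⟩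
  · exact Or.inr ⟨Or.inr ⟨hm h1.1, hm h1.2⟩, Or.inr ⟨hm h2.1, hm h2.2⟩⟩

theorem cr_outside {a c p q r s : ℕ} (hp : p < a ∨ c < p) (hq : a ≤ q ∧ q ≤ c)
    (hr : a ≤ r ∧ r ≤ c) (hs : a ≤ s ∧ s ≤ c) :
    Cr p q r s ↔ (r < q ∧ q < s) ∨ (s < q ∧ q < r) := by
  unfold Cr
  omega

theorem above_inside {a c z x : ℕ} (h : a ≤ x ∧ x ≤ c) : above a c z x = x := if_pos h

theorem above_outside {a c z x : ℕ} (h : ¬ (a ≤ x ∧ x ≤ c)) : above a c z x = z := if_neg h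

theorem collapsing_above {a c z : ℕ} (hz : z < a ∨ c < z) : Collapsing (above a c z) := by
  refine collapsing_of_sorted fun p q r s h1 h2 h3 => ?_
  by_cases hp : a ≤ p ∧ p ≤ c <;> by_cases hs : a ≤ s ∧ s ≤ c
  · have hq : a ≤ q ∧ q ≤ c := by omega
    have hr : a ≤ r ∧ r ≤ c := by omega
    rw [above_inside hp, above_inside hs, above_inside hq, above_inside hr]
    left
    rw [cr_iff (by omega) (by omega)]
    omega
  · by_cases hr : a ≤ r ∧ r ≤ c
    · have hq : a ≤ q ∧ q ≤ c := by omega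
      rw [above_inside hp, above_outside hs, above_inside hq, above_inside hr]
      left
      rw [cr_comm, cr_swap_left, cr_outside hz hq hp hr]
      omega
    · rw [above_outside hs, above_outside hr]
      simp
  · by_cases hq : a ≤ q ∧ q ≤ c
    · have hr : a ≤ r ∧ r ≤ c := by omega
      rw [above_outside hp, above_inside hs, above_inside hq, above_inside hr]
      left
      rw [cr_outside hz hr hq hs]
      omega
    · rw [above_outside hp, above_outside hq]
      simp
  · rw [above_outside hp, above_outside hs]
    simp

theorem above_reflect {a c z p q r s : ℕ} (hz : z < a ∨ c < z)
    (h : Cr (above a c z p) (above a c z q) (above a c z r) (above a c z s)) : Cr p q r s := by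
  have key : ∀ {p q r s : ℕ}, ¬ (a ≤ p ∧ p ≤ c) →
      Cr (above a c z p) (above a c z q) (above a c z r) (above a c z s) → Cr p q r s := by
    intro p q r s hp h
    obtain ⟨n1, n2, n3, n4, n5, n6⟩ := h.pairwise_ne
    rw [above_outside hp] at h n1 n4 n5
    have hout : ∀ x, z ≠ above a c z x → a ≤ x ∧ x ≤ c := by
      intro x hx
      by_contra hcon
      exact hx (above_outside hcon).symm
    have hq := hout q n5
    have hr := hout r n1
    have hs := hout s n4.symm
    rw [above_inside hq, above_inside hr, above_inside hs, cr_outside hz hq hr hs] at h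
    rwa [cr_outside (by omega) hq hr hs]
  by_cases hp : a ≤ p ∧ p ≤ c
  · by_cases hq : a ≤ q ∧ q ≤ c
    · by_cases hr : a ≤ r ∧ r ≤ c
      · by_cases hs : a ≤ s ∧ s ≤ c
        · rwa [above_inside hp, above_inside hq, above_inside hr, above_inside hs] at h
        · rw [cr_comm, cr_swap_left] at h ⊢
          exact key hs h
      · rw [cr_comm] at h ⊢
        exact key hr h
    · rw [cr_swap_left] at h ⊢
      exact key hq h
  · exact key hp h

/-- `below` leaves only two images for the interval [a, c], so survival there allows at most two
corners in it. `above` sends everything outside to z, so survival there requires at least three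
corners in it. Hence no flip is counted on both sides of a c. -/
theorem not_cr_below_and_above {a c z p q r s : ℕ}
    (h1 : Cr (below a c p) (below a c q) (below a c r) (below a c s))
    (h2 : Cr (above a c z p) (above a c z q) (above a c z r) (above a c z s)) : False := by
  obtain ⟨m1, m2, m3, m4, m5, m6⟩ := h1.pairwise_ne
  obtain ⟨n1, n2, n3, n4, n5, n6⟩ := h2.pairwise_ne
  have h3 : ∀ {x y w}, (a ≤ x ∧ x ≤ c) → (a ≤ y ∧ y ≤ c) → (a ≤ w ∧ w ≤ c) →
      below a c x ≠ below a c y → below a c y ≠ below a c w → below a c w ≠ below a c x →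
      False := by
    intro x y w hx hy hw
    have e1 := below_cases a c x
    have e2 := below_cases a c y
    have e3 := below_cases a c w
    omega
  have h4 : ∀ {x y}, above a c z x ≠ above a c z y → (a ≤ x ∧ x ≤ c) ∨ (a ≤ y ∧ y ≤ c) := by
    intro x y hxy
    by_contra hcon
    rw [not_or] at hcon
    rw [above_outside hcon.1, above_outside hcon.2] at hxy
    exact hxy rfl
  by_cases hp : a ≤ p ∧ p ≤ c
  · by_cases hq : a ≤ q ∧ q ≤ c
    · rcases h4 n6 with hr | hs
      · exact h3 hp hr hq m1 m2 m5.symm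
      · exact h3 hp hq hs m5 m3 m4
    · exact h3 hp ((h4 n2).resolve_right hq) ((h4 n3).resolve_left hq) m1 m6 m4
  · exact h3 ((h4 n5).resolve_left hp) ((h4 n1).resolve_left hp) ((h4 n4).resolve_right hp)
      m2.symm m6 m3.symm

theorem NC.im {V W E} (h : NC V E) {χ : ℕ → ℕ} (hχ : ∀ {p q r s}, Cr (χ p) (χ q) (χ r) (χ s) → Cr p q r s)
    (hVW : ∀ x ∈ V, χ x ∈ W) : NC W (im χ E) where
  symm := by
    rintro x y ⟨hne, x', y', hE, rfl, rfl⟩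
    exact ⟨hne.symm, y', x', h.symm hE, rfl, rfl⟩
  mem := by
    rintro x y ⟨hne, x', y', hE, rfl, rfl⟩
    exact hVW _ (h.mem hE)
  ne := fun h1 => h1.1
  nc := by
    rintro p q r s ⟨-, p', q', hE, rfl, rfl⟩ ⟨-, r', s', hE', rfl, rfl⟩ hcr
    exact h.nc hE hE' (hχ hcr)

/-! ### Pockets and long degrees -/

/-- The vertices strictly between `a` and `c`. -/
def inner (V : Finset ℕ) (a c : ℕ) : Finset ℕ := V.filter fun x => a < x ∧ x < c

open Classical in
/-- The neighbours of `v` between `a` and `c` that are separated from `v` by a vertex. -/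
noncomputable def long (V : Finset ℕ) (E : ℕ → ℕ → Prop) (a c v : ℕ) : Finset ℕ :=
  V.filter fun x => (a ≤ x ∧ x ≤ c) ∧ E v x ∧ ∃ w ∈ V, (v < w ∧ w < x) ∨ (x < w ∧ w < v)

theorem mem_inner {V : Finset ℕ} {a c x : ℕ} : x ∈ inner V a c ↔ x ∈ V ∧ a < x ∧ x < c :=
  Finset.mem_filter

theorem mem_long {V : Finset ℕ} {E : ℕ → ℕ → Prop} {a c v x : ℕ} : x ∈ long V E a c v ↔
    x ∈ V ∧ (a ≤ x ∧ x ≤ c) ∧ E v x ∧ ∃ w ∈ V, (v < w ∧ w < x) ∨ (x < w ∧ w < v) := by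
  classical
  exact Finset.mem_filter

/-- Besides its long neighbours, a vertex of a pocket has two more neighbours in the pocket or in
the apex of the pocket. -/
theorem Tri.exists_short {V E} (h : Tri V E) {a c v z : ℕ} (hE : E a c) (hac : a < c)
    (hv : v ∈ V) (hav : a ≤ v) (hvc : v ≤ c) (hz : z < a ∨ c < z) :
    ∃ α β, α ≠ β ∧ α ∉ long V E a c v ∧ β ∉ long V E a c v ∧
      (∀ x, a ≤ x → x ≤ c → E v x → x ∈ long V E a c v ∨ x = α ∨ x = β) ∧
      ((a ≤ α ∧ α ≤ c ∧ E v α) ∨ (α = z ∧ v = a)) ∧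
      ((a ≤ β ∧ β ≤ c ∧ E v β) ∨ (β = z ∧ v = c)) ∧ ((v = a ∨ v = c) → (z = α ∨ z = β)) := by
  have hzl : z ∉ long V E a c v := fun h1 => by
    have := (mem_long.1 h1).2.1
    omega
  have key : ∀ x, E v x → ∀ w, E v w → a ≤ x → x ≤ c → ((v < w ∧ w < x) ∨ (x < w ∧ w < v)) →
      x ∈ long V E a c v := fun x hx w hw h1 h2 h3 =>
    mem_long.2 ⟨h.mem_right hx, ⟨h1, h2⟩, hx, w, h.mem_right hw, h3⟩
  have hsucc : v < c → ∃ s, v < s ∧ s ≤ c ∧ E v s ∧ ∀ w ∈ V, ¬ (v < w ∧ w < s) := by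
    intro hlt
    obtain ⟨s, hs, h1, h2, h3⟩ := exists_succ (h.mem_right hE) hlt
    exact ⟨s, h1, h2, h.of_no_between hv hs h1 h3, h3⟩
  have hpred : a < v → ∃ s, s < v ∧ a ≤ s ∧ E v s ∧ ∀ w ∈ V, ¬ (s < w ∧ w < v) := by
    intro hlt
    obtain ⟨s, hs, h1, h2, h3⟩ := exists_pred (h.mem hE) hlt
    exact ⟨s, h1, h2, h.symm (h.of_no_between hs hv h1 h3), h3⟩
  have hsl : ∀ s, v < s → (∀ w ∈ V, ¬ (v < w ∧ w < s)) → s ∉ long V E a c v := by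
    intro s hvs hs hl
    obtain ⟨-, -, -, w, hw, h1⟩ := mem_long.1 hl
    have := hs w hw
    omega
  have hpl : ∀ s, s < v → (∀ w ∈ V, ¬ (s < w ∧ w < v)) → s ∉ long V E a c v := by
    intro s hvs hs hl
    obtain ⟨-, -, -, w, hw, h1⟩ := mem_long.1 hl
    have := hs w hw
    omega
  rcases hav.eq_or_lt with rfl | hav'
  · obtain ⟨s, h1, h2, h3, h4⟩ := hsucc hac
    refine ⟨z, s, by omega, hzl, hsl s h1 h4, fun x hx1 hx2 hx => ?_, Or.inr ⟨rfl, rfl⟩,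
      Or.inl ⟨by omega, h2, h3⟩, fun _ => Or.inl rfl⟩
    rcases lt_trichotomy x s with g | g | g
    · have := h.ne hx
      exact absurd ⟨by omega, g⟩ (h4 x (h.mem_right hx))
    · exact Or.inr (Or.inr g)
    · exact Or.inl (key x hx s h3 hx1 hx2 (Or.inl ⟨h1, g⟩))
  · obtain ⟨p, p1, p2, p3, p4⟩ := hpred hav'
    rcases hvc.eq_or_lt with rfl | hvc'
    · refine ⟨p, z, by omega, hpl p p1 p4, hzl, fun x hx1 hx2 hx => ?_,
        Or.inl ⟨p2, by omega, p3⟩, Or.inr ⟨rfl, rfl⟩, fun _ => Or.inr rfl⟩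
      rcases lt_trichotomy x p with g | g | g
      · exact Or.inl (key x hx p p3 hx1 hx2 (Or.inr ⟨g, p1⟩))
      · exact Or.inr (Or.inl g)
      · have := h.ne hx
        exact absurd ⟨g, by omega⟩ (p4 x (h.mem_right hx))
    · obtain ⟨s, h1, h2, h3, h4⟩ := hsucc hvc'
      refine ⟨p, s, by omega, hpl p p1 p4, hsl s h1 h4, fun x hx1 hx2 hx => ?_,
        Or.inl ⟨p2, by omega, p3⟩, Or.inl ⟨by omega, h2, h3⟩, fun _ => by omega⟩
      rcases lt_trichotomy x v with g | g | g
      · rcases lt_trichotomy x p with g' | g' | g'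
        · exact Or.inl (key x hx p p3 hx1 hx2 (Or.inr ⟨g', p1⟩))
        · exact Or.inr (Or.inl g')
        · exact absurd ⟨g', g⟩ (p4 x (h.mem_right hx))
      · exact absurd g.symm (h.ne hx)
      · rcases lt_trichotomy x s with g' | g' | g'
        · exact absurd ⟨g, g'⟩ (h4 x (h.mem_right hx))
        · exact Or.inr (Or.inr g')
        · exact Or.inl (key x hx s h3 hx1 hx2 (Or.inl ⟨h1, g'⟩))

open Classical in
theorem Tri.long_card_add_two_le {V E} (h : Tri V E) {a c v w : ℕ} (hE : E a c) (hac : a < c)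
    (hv : v ∈ V) (hav : a ≤ v) (hvc : v ≤ c) (hw : w ∈ V) (hwo : w < a ∨ c < w) :
    (long V E a c v).card + 2 ≤ (V.filter (E v)).card := by
  obtain ⟨z, -, hz, hza, hzc⟩ := h.apex_outside hE hac hw hwo
  obtain ⟨α, β, hne, hα, hβ, -, hEα, hEβ, -⟩ := h.exists_short hE hac hv hav hvc hz
  have hEα' : E v α := by
    rcases hEα with h1 | ⟨rfl, rfl⟩
    · exact h1.2.2
    · exact hza
  have hEβ' : E v β := by
    rcases hEβ with h1 | ⟨rfl, rfl⟩
    · exact h1.2.2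
    · exact hzc
  have hsub : insert α (insert β (long V E a c v)) ⊆ V.filter (E v) := by
    intro x hx
    rw [Finset.mem_insert, Finset.mem_insert] at hx
    rw [Finset.mem_filter]
    rcases hx with rfl | rfl | hx
    · exact ⟨h.mem_right hEα', hEα'⟩
    · exact ⟨h.mem_right hEβ', hEβ'⟩
    · exact ⟨(mem_long.1 hx).1, (mem_long.1 hx).2.2.1⟩
  have := Finset.card_le_card hsub
  rwa [Finset.card_insert_of_notMem (by simp [hne, hα]), Finset.card_insert_of_notMem hβ] at this

/-- The vertices of a pocket together with an outer vertex. -/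
def pocket (V : Finset ℕ) (a c z : ℕ) : Finset ℕ := insert z (V.filter fun x => a ≤ x ∧ x ≤ c)

theorem mem_pocket {V : Finset ℕ} {a c z x : ℕ} :
    x ∈ pocket V a c z ↔ x = z ∨ (x ∈ V ∧ a ≤ x ∧ x ≤ c) := by
  rw [pocket, Finset.mem_insert, Finset.mem_filter]

theorem card_pocket {V : Finset ℕ} {a c z : ℕ} (ha : a ∈ V) (hc : c ∈ V) (hac : a < c)
    (hz : z < a ∨ c < z) : (pocket V a c z).card = (inner V a c).card + 3 := by
  have h1 : (V.filter fun x => a ≤ x ∧ x ≤ c) = insert a (insert c (inner V a c)) := by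
    ext x
    rw [Finset.mem_insert, Finset.mem_insert, Finset.mem_filter, mem_inner]
    constructor
    · rintro ⟨h1, h2⟩
      by_cases e1 : x = a
      · exact Or.inl e1
      by_cases e2 : x = c
      · exact Or.inr (Or.inl e2)
      exact Or.inr (Or.inr ⟨h1, by omega⟩)
    · rintro (rfl | rfl | h1)
      · exact ⟨ha, by omega⟩
      · exact ⟨hc, by omega⟩
      · exact ⟨h1.1, by omega⟩
  rw [pocket, Finset.card_insert_of_notMem (by
      rw [Finset.mem_filter]; omega), h1, Finset.card_insert_of_notMem (by
      rw [Finset.mem_insert, mem_inner]; omega), Finset.card_insert_of_notMem (by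
      rw [mem_inner]; omega)]

theorem above_mem_pocket {V : Finset ℕ} {a c z x : ℕ} (hx : x ∈ V) :
    above a c z x ∈ pocket V a c z := by
  rw [mem_pocket]
  rcases above_cases a c z x with h | h
  · exact Or.inr ⟨by rwa [h.2.2], by omega⟩
  · exact Or.inl h.2

theorem im_above_inside {E : ℕ → ℕ → Prop} {a c z x y : ℕ} (hz : z < a ∨ c < z)
    (hne : ∀ x y, E x y → x ≠ y) (hx : a ≤ x ∧ x ≤ c) (hy : a ≤ y ∧ y ≤ c) :
    im (above a c z) E x y ↔ E x y := by
  constructor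
  · rintro ⟨-, x', y', hE, h1, h2⟩
    have e1 := above_cases a c z x'
    have e2 := above_cases a c z y'
    obtain rfl : x' = x := by omega
    obtain rfl : y' = y := by omega
    exact hE
  · intro hE
    exact ⟨hne _ _ hE, x, y, hE, above_inside hx, above_inside hy⟩

/-- An edge leaving the open interval would cross a c, while the triangle beyond a c supplies the
edges from a and c to z. -/
theorem Tri.im_above_apex {V E} (h : Tri V E) {a c z w x : ℕ} (hE : E a c) (hac : a < c)
    (hz : z < a ∨ c < z) (hw : w ∈ V) (hwo : w < a ∨ c < w) (hx : a ≤ x ∧ x ≤ c) :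
    im (above a c z) E x z ↔ x = a ∨ x = c := by
  constructor
  · rintro ⟨-, x', y', hE', h1, h2⟩
    have e1 := above_cases a c z x'
    have e2 := above_cases a c z y'
    obtain rfl : x' = x := by omega
    by_contra hcon
    have := h.nc hE hE'
    unfold Cr at this
    omega
  · obtain ⟨u, -, hu, hua, huc⟩ := h.apex_outside hE hac hw hwo
    rintro (rfl | rfl)
    · exact ⟨by omega, _, _, hua, above_inside hx, above_outside (by omega)⟩
    · exact ⟨by omega, _, _, huc, above_inside hx, above_outside (by omega)⟩

theorem Tri.im_above {V E} (h : Tri V E) {a c z w : ℕ} (hE : E a c) (hac : a < c)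
    (hz : z < a ∨ c < z) (hw : w ∈ V) (hwo : w < a ∨ c < w) :
    Tri (pocket V a c z) (im (above a c z) E) := by
  have hNC : NC (pocket V a c z) (FlipGraph.im (above a c z) E) :=
    h.toNC.im (above_reflect hz) fun x hx => above_mem_pocket hx
  have hap : ∀ x, x ∈ V → a ≤ x ∧ x ≤ c → (∀ r s, FlipGraph.im (above a c z) E r s → ¬ Cr x z r s) →
      FlipGraph.im (above a c z) E x z := by
    intro x hxV hx hc
    rw [h.im_above_apex hE hac hz hw hwo hx]
    have h1 := hc a c ((im_above_inside hz (fun _ _ => h.ne) (by omega) (by omega)).2 hE)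
    unfold Cr at h1
    omega
  refine { hNC with max := ?_ }
  intro x y hx hy hne hc
  rw [mem_pocket] at hx hy
  rcases hx with rfl | ⟨hxV, hx⟩
  · rcases hy with rfl | ⟨hyV, hy⟩
    · exact absurd rfl hne
    · exact hNC.symm (hap y hyV hy fun r s hrs hcr => hc r s hrs (cr_swap_left.1 hcr))
  · rcases hy with rfl | ⟨hyV, hy⟩
    · exact hap x hxV hx hc
    · rw [im_above_inside hz (fun _ _ => h.ne) hx hy]
      refine h.max hxV hyV hne fun r s hrs hcr => ?_
      have h1 := h.nc hE hrs
      by_cases hr : a ≤ r ∧ r ≤ c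
      · by_cases hs : a ≤ s ∧ s ≤ c
        · exact hc r s ((im_above_inside hz (fun _ _ => h.ne) hr hs).2 hrs) hcr
        · have : r = a ∨ r = c := by
            unfold Cr at h1
            omega
          unfold Cr at hcr
          omega
      · have : ¬ (a < s ∧ s < c) := by
          intro hs
          unfold Cr at h1
          omega
        unfold Cr at hcr
        omega

-- At an end of a c the vertex z takes the place of the missing boundary neighbour, so there are
-- always exactly two short neighbours.
open Classical in
theorem Tri.card_im_above {V E} (h : Tri V E) {a c v z w : ℕ} (hE : E a c) (hac : a < c)
    (hv : v ∈ V) (hav : a ≤ v) (hvc : v ≤ c) (hz : z < a ∨ c < z) (hw : w ∈ V)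
    (hwo : w < a ∨ c < w) :
    ((pocket V a c z).filter (FlipGraph.im (above a c z) E v)).card =
      (long V E a c v).card + 2 := by
  obtain ⟨α, β, hne, hα, hβ, hall, hEα, hEβ, hzz⟩ := h.exists_short hE hac hv hav hvc hz
  have heq : (pocket V a c z).filter (FlipGraph.im (above a c z) E v) =
      insert α (insert β (long V E a c v)) := by
    have hva := h.im_above_apex hE hac hz hw hwo ⟨hav, hvc⟩
    have hin : ∀ {x}, a ≤ x ∧ x ≤ c → (FlipGraph.im (above a c z) E v x ↔ E v x) :=
      fun hx => im_above_inside hz (fun _ _ => h.ne) ⟨hav, hvc⟩ hx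
    ext x
    rw [Finset.mem_filter, mem_pocket, Finset.mem_insert, Finset.mem_insert]
    constructor
    · rintro ⟨rfl | ⟨hxV, hx⟩, h1⟩
      · rcases hzz (hva.1 h1) with h2 | h2
        · exact Or.inl h2
        · exact Or.inr (Or.inl h2)
      · rw [hin hx] at h1
        rcases hall x hx.1 hx.2 h1 with h2 | h2 | h2
        · exact Or.inr (Or.inr h2)
        · exact Or.inl h2
        · exact Or.inr (Or.inl h2)
    · rintro (rfl | rfl | h1)
      · rcases hEα with ⟨h1, h2, h3⟩ | ⟨rfl, h1⟩
        · exact ⟨Or.inr ⟨h.mem_right h3, h1, h2⟩, (hin ⟨h1, h2⟩).2 h3⟩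
        · exact ⟨Or.inl rfl, hva.2 (Or.inl h1)⟩
      · rcases hEβ with ⟨h1, h2, h3⟩ | ⟨rfl, h1⟩
        · exact ⟨Or.inr ⟨h.mem_right h3, h1, h2⟩, (hin ⟨h1, h2⟩).2 h3⟩
        · exact ⟨Or.inl rfl, hva.2 (Or.inr h1)⟩
      · obtain ⟨h2, h3, h4, -⟩ := mem_long.1 h1
        exact ⟨Or.inr ⟨h2, h3⟩, (hin h3).2 h4⟩
  rw [heq, Finset.card_insert_of_notMem (by simp [hne, hα]), Finset.card_insert_of_notMem hβ]

/-! ### Gluing a target from its two contractions -/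

/-- The vertices that are not strictly between `a` and `c`. -/
def outer (V : Finset ℕ) (a c : ℕ) : Finset ℕ := V.filter fun x => ¬ (a < x ∧ x < c)

theorem mem_outer {V : Finset ℕ} {a c x : ℕ} : x ∈ outer V a c ↔ x ∈ V ∧ ¬ (a < x ∧ x < c) :=
  Finset.mem_filter

theorem card_inner_add_outer (V : Finset ℕ) (a c : ℕ) :
    (inner V a c).card + (outer V a c).card = V.card :=
  Finset.card_filter_add_card_filter_not _

theorem below_mem_outer {V : Finset ℕ} {a c x : ℕ} (ha : a ∈ V) (hx : x ∈ V) :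
    below a c x ∈ outer V a c := by
  rw [mem_outer]
  rcases below_cases a c x with h | h
  · exact ⟨by rwa [h.2.2], by omega⟩
  · exact ⟨by rwa [h.2], by omega⟩

theorem im_below_eq {V E} (h : Tri V E) {a c : ℕ} (hE : E a c) (hac : a < c) :
    im (below a c) E = fun x y => E x y ∧ ¬ (a < x ∧ x < c) ∧ ¬ (a < y ∧ y < c) := by
  funext x y
  apply propext
  constructor
  · rintro ⟨hne, x', y', hE', rfl, rfl⟩
    have h1 := h.nc hE hE'
    rcases below_cases a c x' with hx | hx
    · have hy' : a ≤ y' ∧ y' ≤ c := by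
        unfold Cr at h1
        omega
      have hy : below a c y' = a ∨ below a c y' = c := by
        have := below_cases a c y'
        omega
      rw [hx.2.2] at hne ⊢
      rw [hy.resolve_left hne.symm]
      exact ⟨hE, by omega, by omega⟩
    · rcases below_cases a c y' with hy | hy
      · have hx' : x' = a ∨ x' = c := by
          unfold Cr at h1
          omega
        rw [hy.2.2, hx.2] at hne ⊢
        rw [hx'.resolve_left hne]
        exact ⟨h.symm hE, by omega, by omega⟩
      · rw [hx.2, hy.2]
        exact ⟨hE', by omega, by omega⟩
  · rintro ⟨hE', hx, hy⟩
    refine ⟨h.ne hE', x, y, hE', ?_, ?_⟩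
    · exact if_neg hx
    · exact if_neg hy

/-- Beyond a c the segment from p to z runs inside the triangle a c z, so an outer edge other than a
c that crosses it also crosses a z or c z. -/
theorem not_cr_of_triangle {a c z p x y : ℕ} (hac : a < c)
    (hz : z < a ∨ c < z) (hp : a ≤ p ∧ p ≤ c) (hx : ¬ (a < x ∧ x < c)) (hy : ¬ (a < y ∧ y < c))
    (hxy : x < y) (hn : ¬ (x = a ∧ y = c)) (h1 : ¬ Cr a z x y) (h2 : ¬ Cr c z x y) :
    ¬ Cr p z x y := by
  rcases hz with hz | hz
  · rw [cr_swap_left, cr_iff (by omega) hxy] at h1 h2 ⊢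
    omega
  · rw [cr_iff (by omega) hxy] at h1 h2 ⊢
    omega

/-- A triangulation of the outer vertices and a non-crossing relation on a pocket have a common
extension. -/
theorem Tri.exists_glue {V T D} {a c z : ℕ} (hT : Tri (outer V a c) T) (hac : a < c)
    (hTac : T a c) (hTa : T a z) (hTc : T c z) (hz : z < a ∨ c < z)
    (hD : NC (pocket V a c z) D) : ∃ E', Tri V E' ∧ im (below a c) E' = T ∧
      ∀ x y, D x y → im (above a c z) E' x y := by
  have haV := (mem_outer.1 (hT.mem hTac)).1
  have hcV := (mem_outer.1 (hT.mem_right hTac)).1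
  have hzV := (mem_outer.1 (hT.mem_right hTa)).1
  have hmem : ∀ {x}, x ∈ pocket V a c z → x ∈ V ∧ ((a ≤ x ∧ x ≤ c) ∨ x = z) := by
    intro x hx
    rcases mem_pocket.1 hx with rfl | hx
    · exact ⟨hzV, Or.inr rfl⟩
    · exact ⟨hx.1, Or.inl hx.2⟩
  have hcross' : ∀ {p q x y}, D p q → T x y → x < y → ¬ (x = a ∧ y = c) → ¬ Cr p q x y := by
    intro p q x y hpq hxy hlt hn
    have hx := (mem_outer.1 (hT.mem hxy)).2
    have hy := (mem_outer.1 (hT.mem_right hxy)).2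
    rcases (hmem (hD.mem hpq)).2 with hp | rfl
    · rcases (hmem (hD.mem_right hpq)).2 with hq | rfl
      · unfold Cr
        omega
      · exact not_cr_of_triangle hac hz hp hx hy hlt hn (hT.nc hTa hxy) (hT.nc hTc hxy)
    · rcases (hmem (hD.mem_right hpq)).2 with hq | rfl
      · rw [cr_swap_left]
        exact not_cr_of_triangle hac hz hq hx hy hlt hn (hT.nc hTa hxy) (hT.nc hTc hxy)
      · exact absurd rfl (hD.ne hpq)
  have hcross : ∀ {p q x y}, D p q → T x y → ¬ (x = a ∧ y = c) → ¬ (x = c ∧ y = a) →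
      ¬ Cr p q x y := by
    intro p q x y hpq hxy h1 h2
    rcases lt_or_gt_of_ne (hT.ne hxy) with hlt | hlt
    · exact hcross' hpq hxy hlt h1
    · rw [cr_swap_right]
      exact hcross' hpq (hT.symm hxy) hlt fun h => h2 ⟨h.2, h.1⟩
  -- The edge a c is left out, since diagonals of D from inside the pocket to z cross it.
  have hNC : NC V (fun x y => D x y ∨ (T x y ∧ ¬ (x = a ∧ y = c) ∧ ¬ (x = c ∧ y = a))) := by
    refine ⟨?_, ?_, ?_, ?_⟩
    · rintro x y (h | ⟨h1, h2, h3⟩)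
      · exact Or.inl (hD.symm h)
      · exact Or.inr ⟨hT.symm h1, fun h => h3 ⟨h.2, h.1⟩, fun h => h2 ⟨h.2, h.1⟩⟩
    · rintro x y (h | h)
      · exact (hmem (hD.mem h)).1
      · exact (mem_outer.1 (hT.mem h.1)).1
    · rintro x y (h | h)
      · exact hD.ne h
      · exact hT.ne h.1
    · rintro p q r s (h | h) (h' | h')
      · exact hD.nc h h'
      · exact hcross h h'.1 h'.2.1 h'.2.2
      · rw [cr_comm]
        exact hcross h' h.1 h.2.1 h.2.2
      · exact hT.nc h.1 h'.1
  obtain ⟨E', hE', hsub⟩ := hNC.extend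
  refine ⟨E', hE', ?_, ?_⟩
  · have hF : NC (outer V a c) (im (below a c) E') :=
      hE'.toNC.im below_reflect fun x hx => below_mem_outer haV hx
    have hTF : ∀ x y, T x y → im (below a c) E' x y := by
      -- The edge a c reappears in the image: the boundary edge from the predecessor of c to c is
      -- contracted onto it.
      have hEac : im (below a c) E' a c := by
        obtain ⟨p, hp, hp1, hp2, hp3⟩ := exists_pred haV hac
        refine ⟨hac.ne, p, c, hE'.of_no_between hp hcV hp1 hp3, ?_, if_neg (by omega)⟩
        have := below_cases a c p
        omega
      intro x y hxy
      by_cases h1 : x = a ∧ y = c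
      · rw [h1.1, h1.2]
        exact hEac
      by_cases h2 : x = c ∧ y = a
      · rw [h2.1, h2.2]
        exact hF.symm hEac
      exact ⟨hT.ne hxy, x, y, hsub _ _ (Or.inr ⟨hxy, h1, h2⟩),
        if_neg (mem_outer.1 (hT.mem hxy)).2, if_neg (mem_outer.1 (hT.mem_right hxy)).2⟩
    funext x y
    apply propext
    refine ⟨fun h => ?_, hTF x y⟩
    exact hT.max (hF.mem h) (hF.mem_right h) (hF.ne h) fun r s hrs => hF.nc h (hTF r s hrs)
  · intro x y hxy
    have hfix : ∀ {x}, x ∈ pocket V a c z → above a c z x = x := by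
      intro x hx
      rcases (hmem hx).2 with h | rfl
      · exact above_inside h
      · exact above_outside (by omega)
    exact ⟨hD.ne hxy, x, y, hsub _ _ (Or.inl hxy), hfix (hD.mem hxy), hfix (hD.mem_right hxy)⟩

open Classical in
/-- A pocket with a vertex of medium degree lets one pass to the outer vertices, with a gain of
five flips for every four vertices lost. -/
theorem Tri.exists_far_of_outer {V E T} (h : Tri V E) {a c v w : ℕ} (hE : E a c) (hac : a < c)
    (hw : w ∈ V) (hwo : w < a ∨ c < w) (hv : v ∈ V) (hav : a ≤ v)
    (hvc : v ≤ c) (h1 : (inner V a c).card + 4 ≤ 4 * (long V E a c v).card)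
    (h2 : 4 * (long V E a c v).card ≤ 3 * (inner V a c).card) (hT : Tri (outer V a c) T) :
    ∃ E', Tri V E' ∧ ∀ l G p q r s J, FlipPath V l G p q r s J → G 0 = E → G l = E' →
      ∃ G' p' q' r' s' J', FlipPath (outer V a c) l G' p' q' r' s' J' ∧
        G' 0 = (fun x y => E x y ∧ ¬ (a < x ∧ x < c) ∧ ¬ (a < y ∧ y < c)) ∧ G' l = T ∧
        4 * J'.card + 5 * (inner V a c).card ≤ 4 * J.card := by
  have ha := h.mem hE
  have hc := h.mem_right hE
  have hTac : T a c := hT.of_no_between (mem_outer.2 ⟨ha, by omega⟩) (mem_outer.2 ⟨hc, by omega⟩)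
    hac fun u hu => (mem_outer.1 hu).2
  obtain ⟨z, hzV, hz, hTa, hTc⟩ := hT.apex_outside hTac hac (mem_outer.2 ⟨hw, by omega⟩) hwo
  have hL := h.im_above hE hac hz hw hwo
  have hS := h.card_im_above hE hac hv hav hvc hz hw hwo
  have hcard := card_pocket ha hc hac hz
  -- Let M be the number of inner vertices and d the long degree of v. The contracted pocket has M +
  -- 3 vertices and v has degree d + 2 there. With q = ⌈M/4⌉, `h1` and `h2` give q + 1 ≤ d and q + d
  -- ≤ M, and the pocket costs M + ⌈M/4⌉ flips.
  obtain ⟨D, hD, hfar⟩ := hL.exists_far (v := v) (mem_pocket.2 (Or.inr ⟨hv, hav, hvc⟩))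
    (q := ((inner V a c).card + 3) / 4) (by omega) (by omega)
  obtain ⟨E', hE', hbelow, habove⟩ := hT.exists_glue hac hTac hTa hTc hz hD
  refine ⟨E', hE', fun l G p q r s J hG hG0 hGl => ?_⟩
  have hp1 := hG.im (W := outer V a c) (collapsing_below a c) fun x hx => below_mem_outer ha hx
  have hp2 := hG.im (W := pocket V a c z) (collapsing_above hz) fun x hx => above_mem_pocket hx
  refine ⟨_, _, _, _, _, _, hp1, ?_, ?_, ?_⟩
  · simp only [hG0]
    exact im_below_eq h hE hac
  · simp only [hGl]
    exact hbelow
  · have hge := hfar _ (hE'.toNC.im (above_reflect hz) fun x hx => above_mem_pocket hx) habove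
      _ _ _ _ _ _ _ hp2 (by simp only [hG0]) (by simp only [hGl])
    have hdisj := Finset.card_union_of_disjoint (Finset.disjoint_filter.2 fun t (_ : t ∈ J)
      (e1 : Cr (below a c (p t)) (below a c (r t)) (below a c (q t)) (below a c (s t)))
      (e2 : Cr (above a c z (p t)) (above a c z (r t)) (above a c z (q t)) (above a c z (s t))) =>
      not_cr_below_and_above e1 e2)
    have hle := Finset.card_le_card (Finset.union_subset (Finset.filter_subset (fun t =>
      Cr (below a c (p t)) (below a c (r t)) (below a c (q t)) (below a c (s t))) J)
      (Finset.filter_subset (fun t =>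
      Cr (above a c z (p t)) (above a c z (r t)) (above a c z (q t)) (above a c z (s t))) J))
    omega

/-! ### Dominating vertices and the main induction -/

theorem card_inner_split {V : Finset ℕ} {a b c : ℕ} (hb : b ∈ V) (hab : a < b) (hbc : b < c) :
    (inner V a c).card = (inner V a b).card + (inner V b c).card + 1 := by
  have h1 : inner V a c = insert b (inner V a b ∪ inner V b c) := by
    ext x
    rw [Finset.mem_insert, Finset.mem_union, mem_inner, mem_inner, mem_inner]
    constructor
    · rintro ⟨h1, h2⟩
      rcases lt_trichotomy x b with h | h | h
      · exact Or.inr (Or.inl ⟨h1, by omega⟩)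
      · exact Or.inl h
      · exact Or.inr (Or.inr ⟨h1, by omega⟩)
    · rintro (rfl | h | h)
      · exact ⟨hb, by omega⟩
      · exact ⟨h.1, by omega⟩
      · exact ⟨h.1, by omega⟩
  rw [h1, Finset.card_insert_of_notMem, Finset.card_union_of_disjoint]
  · rw [Finset.disjoint_left]
    intro x hx hx'
    rw [mem_inner] at hx hx'
    omega
  · rw [Finset.mem_union, mem_inner, mem_inner]
    omega

theorem long_mono {V : Finset ℕ} {E : ℕ → ℕ → Prop} {a b a' b' v : ℕ} (h1 : a' ≤ a) (h2 : b ≤ b') :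
    long V E a b v ⊆ long V E a' b' v := by
  intro x hx
  rw [mem_long] at hx ⊢
  exact ⟨hx.1, by omega, hx.2.2⟩

/-- The gain of one is the edge a c itself, which is long as soon as something lies below it. -/
theorem Tri.long_left {V E} (h : Tri V E) {a b c : ℕ} (hac : E a c) (hb : b ∈ V) (h1 : a < b)
    (h2 : b < c) : (long V E a b a).card + 1 ≤ (long V E a c a).card := by
  have hn : c ∉ long V E a b a := by
    rw [mem_long]
    omega
  rw [← Finset.card_insert_of_notMem hn]
  refine Finset.card_le_card (Finset.insert_subset ?_ (long_mono le_rfl h2.le))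
  exact mem_long.2 ⟨h.mem_right hac, by omega, hac, b, hb, Or.inl ⟨h1, h2⟩⟩

theorem Tri.long_right {V E} (h : Tri V E) {a b c : ℕ} (hac : E a c) (hb : b ∈ V) (h1 : a < b)
    (h2 : b < c) : (long V E b c c).card + 1 ≤ (long V E a c c).card := by
  have hn : a ∉ long V E b c c := by
    rw [mem_long]
    omega
  rw [← Finset.card_insert_of_notMem hn]
  refine Finset.card_le_card (Finset.insert_subset ?_ (long_mono h1.le le_rfl))
  exact mem_long.2 ⟨h.mem hac, by omega, h.symm hac, b, hb, Or.inr ⟨h1, h2⟩⟩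

theorem Tri.long_mid {V E} (h : Tri V E) {a b c : ℕ} (h1 : a < b) (h2 : b < c) :
    (long V E a b b).card + (long V E b c b).card ≤ (long V E a c b).card := by
  rw [← Finset.card_union_of_disjoint]
  · exact Finset.card_le_card (Finset.union_subset (long_mono le_rfl h2.le)
      (long_mono h1.le le_rfl))
  · rw [Finset.disjoint_left]
    intro x hx hx'
    have e1 := mem_long.1 hx
    have e2 := mem_long.1 hx'
    have := h.ne e1.2.2.1
    omega

theorem Tri.long_pos {V E} (h : Tri V E) {a c : ℕ} (hac : E a c)
    (hM : 1 ≤ (inner V a c).card) : 1 ≤ (long V E a c a).card ∧ 1 ≤ (long V E a c c).card := by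
  obtain ⟨b, hb⟩ := Finset.card_pos.1 hM
  rw [mem_inner] at hb
  have h1 := h.long_left hac hb.1 hb.2.1 hb.2.2
  have h2 := h.long_right hac hb.1 hb.2.1 hb.2.2
  omega

theorem Tri.long_two {V E} (h : Tri V E) {a c : ℕ} (hac : E a c)
    (hM : 2 ≤ (inner V a c).card) : 2 ≤ (long V E a c a).card ∨ 2 ≤ (long V E a c c).card := by
  obtain ⟨w, hw⟩ := Finset.card_pos.1 (show 0 < (inner V a c).card by omega)
  rw [mem_inner] at hw
  obtain ⟨b, hb, h1, h2, hab, hbc⟩ := h.apex hac hw.1 hw.2.1 hw.2.2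
  have h3 := card_inner_split hb h1 h2
  have h4 := h.long_left hac hb h1 h2
  have h5 := h.long_right hac hb h1 h2
  by_cases h6 : 1 ≤ (inner V a b).card
  · have := (h.long_pos hab h6).1
    omega
  · have := (h.long_pos hbc (by omega)).2
    omega

/-- If no pocket has a vertex of medium degree, then every pocket has a vertex that is incident to
more than three quarters of its edges. -/
theorem Tri.exists_dominating {V E} (h : Tri V E)
    (hnr : ∀ a c v w, E a c → a < c → v ∈ V → a ≤ v → v ≤ c → w ∈ V → (w < a ∨ c < w) →
      ¬ ((inner V a c).card + 4 ≤ 4 * (long V E a c v).card ∧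
        4 * (long V E a c v).card ≤ 3 * (inner V a c).card)) :
    ∀ N a c w, (inner V a c).card = N → E a c → a < c → w ∈ V → (w < a ∨ c < w) → 1 ≤ N →
      ∃ v ∈ V, a ≤ v ∧ v ≤ c ∧ 3 * N < 4 * (long V E a c v).card := by
  intro N
  induction N using Nat.strong_induction_on with
  | _ N ih =>
  intro a c w hN hE hac hw hwo hpos
  subst hN
  obtain ⟨u, hu⟩ := Finset.card_pos.1 hpos
  rw [mem_inner] at hu
  obtain ⟨b, hb, h1, h2, hab, hbc⟩ := h.apex hE hu.1 hu.2.1 hu.2.2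
  have hsplit := card_inner_split hb h1 h2
  have hleft := h.long_left hE hb h1 h2
  have hright := h.long_right hE hb h1 h2
  have hmid := h.long_mid h1 h2
  have ha := h.mem hE
  have hc := h.mem_right hE
  -- By `hnr`, reaching the lower threshold forces passing the upper one. With a single inner
  -- vertex, the edge a c alone is enough.
  suffices hs : (inner V a c).card = 1 ∨ ∃ v ∈ V, a ≤ v ∧ v ≤ c ∧
      (inner V a c).card + 4 ≤ 4 * (long V E a c v).card by
    rcases hs with hs | ⟨v, hv, hav, hvc, hs⟩
    · exact ⟨a, ha, le_rfl, hac.le, by omega⟩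
    · have := hnr a c v w hE hac hv hav hvc hw hwo
      exact ⟨v, hv, hav, hvc, by omega⟩
  by_cases hone : (inner V a c).card = 1
  · exact Or.inl hone
  right
  have hpl := h.long_pos hab
  have hpr := h.long_pos hbc
  have htl := h.long_two hab
  rcases le_total (inner V b c).card (inner V a b).card with hle | hle
  · by_cases hM1 : (inner V a b).card = 1
    · exact ⟨a, ha, le_rfl, hac.le, by omega⟩
    -- Here induction yields long degree two, but three is needed. The third long edge is a c if the
    -- vertex is a, and comes from the pocket b c if it is b.
    by_cases hM2 : (inner V a b).card = 2 ∧ (inner V b c).card = 2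
    · rcases htl (by omega) with h3 | h3
      · exact ⟨a, ha, le_rfl, hac.le, by omega⟩
      · exact ⟨b, hb, h1.le, h2.le, by omega⟩
    obtain ⟨v, hv, hav, hvb, hd⟩ := ih (inner V a b).card (by omega) a b w rfl hab h1 hw (by omega) (by omega)
    have := Finset.card_le_card (long_mono (V := V) (E := E) (v := v) (le_refl a) h2.le)
    exact ⟨v, hv, hav, by omega, by omega⟩
  · by_cases hM1 : (inner V b c).card = 1
    · exact ⟨c, hc, hac.le, le_rfl, by omega⟩
    by_cases hM2 : (inner V a b).card = 2 ∧ (inner V b c).card = 2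
    · rcases htl (by omega) with h3 | h3
      · exact ⟨a, ha, le_rfl, hac.le, by omega⟩
      · exact ⟨b, hb, h1.le, h2.le, by omega⟩
    obtain ⟨v, hv, hav, hvb, hd⟩ := ih (inner V b c).card (by omega) b c w rfl hbc h2 hw (by omega) (by omega)
    have := Finset.card_le_card (long_mono (V := V) (E := E) (v := v) h1.le (le_refl c))
    exact ⟨v, hv, by omega, hvb, by omega⟩

open Classical in
/-- A triangulation whose vertices have interior degree at most `D` has another one at distance
at least `(5 |V| - 24 - D) / 4`. -/
theorem Tri.exists_far_of_degree_le {V E} (h : Tri V E) {D : ℕ} (hV : 3 ≤ V.card)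
    (hD : ∀ v ∈ V, (V.filter (E v)).card ≤ D + 2) :
    ∃ E', Tri V E' ∧ ∀ l G a b c d J, FlipPath V l G a b c d J → G 0 = E → G l = E' →
      5 * V.card ≤ 4 * J.card + 24 + D := by
  induction hN : V.card using Nat.strong_induction_on generalizing V E with
  | _ N ih =>
  subst hN
  by_cases hex : ∃ a c v w, E a c ∧ a < c ∧ v ∈ V ∧ a ≤ v ∧ v ≤ c ∧ w ∈ V ∧ (w < a ∨ c < w) ∧
      (inner V a c).card + 4 ≤ 4 * (long V E a c v).card ∧
        4 * (long V E a c v).card ≤ 3 * (inner V a c).card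
  · obtain ⟨a, c, v, w, hE, hac, hv, hav, hvc, hw, hwo, h1, h2⟩ := hex
    have hcard := card_inner_add_outer V a c
    have ha := h.mem hE
    have hc := h.mem_right hE
    have h3 : 3 ≤ (outer V a c).card := by
      have hsub : ({a, c, w} : Finset ℕ) ⊆ outer V a c := by
        intro x hx
        simp only [Finset.mem_insert, Finset.mem_singleton] at hx
        rw [mem_outer]
        rcases hx with rfl | rfl | rfl
        · exact ⟨ha, by omega⟩
        · exact ⟨hc, by omega⟩
        · exact ⟨hw, by omega⟩
      have := Finset.card_le_card hsub
      rwa [Finset.card_eq_three.2 ⟨a, c, w, by omega, by omega, by omega, rfl⟩] at this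
    obtain ⟨T, hT, hTfar⟩ := ih (outer V a c).card (by omega) (h.restrict hE hac) h3
      (fun u hu => by
        refine (Finset.card_le_card fun x hx => ?_).trans (hD u (mem_outer.1 hu).1)
        have hx' := (@Finset.mem_filter _ _ (_) _ _).1 hx
        exact Finset.mem_filter.2 ⟨(mem_outer.1 hx'.1).1, hx'.2.1⟩) rfl
    obtain ⟨E', hE', hfar⟩ := h.exists_far_of_outer hE hac hw hwo hv hav hvc h1 h2 hT
    refine ⟨E', hE', fun l G p q r s J hG hG0 hGl => ?_⟩
    obtain ⟨G', p', q', r', s', J', hG', hG'0, hG'l, hJ⟩ := hfar l G p q r s J hG hG0 hGl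
    have := hTfar l G' p' q' r' s' J' hG' hG'0 hG'l
    omega
  -- Up to four vertices the lower bound is negative.
  · by_cases h3 : V.card ≤ 4
    · exact ⟨E, h, fun l G a b c d J _ _ _ => by omega⟩
    have hdom := h.exists_dominating (by
      intro a c v w h1 h2 h3 h4 h5 h6 h7 h8
      exact hex ⟨a, c, v, w, h1, h2, h3, h4, h5, h6, h7, h8⟩)
    have hne : V.Nonempty := Finset.card_pos.1 (by omega)
    obtain ⟨m, hm, hmin⟩ := V.exists_min_image id hne
    obtain ⟨M, hM, hmax⟩ := V.exists_max_image id hne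
    simp only [id] at hmin hmax
    have hVsub : V = insert m (insert M (inner V m M)) := by
      ext x
      rw [Finset.mem_insert, Finset.mem_insert, mem_inner]
      constructor
      · intro hx
        have h1 := hmin x hx
        have h2 := hmax x hx
        by_cases e1 : x = m
        · exact Or.inl e1
        by_cases e2 : x = M
        · exact Or.inr (Or.inl e2)
        exact Or.inr (Or.inr ⟨hx, by omega⟩)
      · rintro (rfl | rfl | hx)
        · exact hm
        · exact hM
        · exact hx.1
    have hcardI : V.card ≤ (inner V m M).card + 2 := by
      have h1 := Finset.card_insert_le m (insert M (inner V m M))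
      have h2 := Finset.card_insert_le M (inner V m M)
      rw [← hVsub] at h1
      omega
    obtain ⟨u, hu⟩ := Finset.card_pos.1 (show 0 < (inner V m M).card by omega)
    rw [mem_inner] at hu
    have hmM : E m M := h.of_no_outside hm hM (by omega) fun x hx => ⟨hmin x hx, hmax x hx⟩
    obtain ⟨b, hb, h1, h2, hmb, hbM⟩ := h.apex hmM hu.1 hu.2.1 hu.2.2
    have hsplit := card_inner_split hb h1 h2
    -- The larger of the two pockets has at least (|V| - 3)/2 inner vertices, and v has more than
    -- three quarters as many long neighbours in it, plus two short ones.
    obtain ⟨v, hv, hdeg⟩ : ∃ v ∈ V, 3 * V.card ≤ 8 * (V.filter (E v)).card - 8 := by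
      rcases le_total (inner V b M).card (inner V m b).card with hle | hle
      · obtain ⟨v, hv, hv1, hv2, hd⟩ := hdom _ m b M rfl hmb h1 hM (Or.inr h2) (by omega)
        have := h.long_card_add_two_le hmb h1 hv hv1 hv2 hM (Or.inr h2)
        exact ⟨v, hv, by omega⟩
      · obtain ⟨v, hv, hv1, hv2, hd⟩ := hdom _ b M m rfl hbM h2 hm (Or.inl h1) (by omega)
        have := h.long_card_add_two_le hbM h2 hv hv1 hv2 hm (Or.inl h1)
        exact ⟨v, hv, by omega⟩
    have hDv := hD v hv
    have hlt : (V.filter (E v)).card < V.card :=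
      Finset.card_lt_card (Finset.filter_ssubset.2 ⟨v, hv, fun hvv => h.ne hvv rfl⟩)
    -- If the first term is the minimum, the bound follows from deg v ≤ D + 2 and deg v < |V|;
    -- otherwise it follows from deg v > 3|V|/8.
    obtain ⟨q, hq⟩ : ∃ q, q = min (V.card - (V.filter (E v)).card - 1)
      ((V.filter (E v)).card - 3) := ⟨_, rfl⟩
    obtain ⟨F₀, hF₀, hfar⟩ := h.exists_far hv (q := q) (by omega) (by omega)
    obtain ⟨F, hF, hsub⟩ := hF₀.extend
    refine ⟨F, hF, fun l G a b c d J hG hG0 hGl => ?_⟩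
    have := hfar F hF.toNC hsub l G a b c d J hG hG0 hGl
    omega

/-! ### Single-edge exchanges are flips; flipping towards a fan -/

/-- A chord entering the quadrilateral through the side a b leaves it through another side or at c
or d, and meets a diagonal on the way. -/
theorem cr_of_cr_side {a b c d r s : ℕ} (h : Cr a c b d) (h' : Cr a b r s) :
    Cr a c r s ∨ Cr b d r s := by
  wlog hrs : r < s generalizing r s
  · have hne := h'.pairwise_ne
    rw [@cr_swap_right a c, @cr_swap_right b d]
    exact this (cr_swap_right.1 h') (by omega)
  have key : ∀ x y, Cr x y r s ↔ (r < x ∧ x < s ∧ (y < r ∨ s < y)) ∨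
      (r < y ∧ y < s ∧ (x < r ∨ s < x)) := by
    intro x y
    unfold Cr
    omega
  rw [key] at h' ⊢
  rw [key b d]
  by_contra hcon
  rw [not_or] at hcon
  obtain ⟨h1, h2⟩ := hcon
  rcases h with ⟨h3 | h3, h4 | h4⟩ | ⟨h3 | h3, h4 | h4⟩ <;> omega

theorem Tri.flip_side {V E E'} (h : Tri V E) {a b c d : ℕ} (ha : a ∈ V) (hb : b ∈ V)
    (hcr : Cr a c b d) (hac : E a c) (hbd : E' b d) (h' : Tri V E')
    (hold : ∀ x y, E x y → E' x y ∨ (x = a ∧ y = c) ∨ (x = c ∧ y = a)) : E a b := by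
  refine h.max ha hb hcr.pairwise_ne.1 fun r s hrs hc => ?_
  rcases cr_of_cr_side hcr hc with h1 | h1
  · exact h.nc hac hrs h1
  · rcases hold r s hrs with h2 | ⟨rfl, rfl⟩ | ⟨rfl, rfl⟩
    · exact h'.nc hbd h2 h1
    · have := hc.pairwise_ne
      omega
    · have := hc.pairwise_ne
      omega

/-- Two triangulations that differ by a single edge differ by a flip. -/
theorem Tri.flip {V E E'} (h : Tri V E) (h' : Tri V E') {a b c d : ℕ} (hac : E a c)
    (hac' : ¬ E' a c) (hbd' : E' b d)
    (hnew : ∀ x y, E' x y → E x y ∨ (x = b ∧ y = d) ∨ (x = d ∧ y = b))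
    (hold : ∀ x y, E x y → E' x y ∨ (x = a ∧ y = c) ∨ (x = c ∧ y = a)) : Flip E E' a b c d := by
  have ha := h.mem hac
  have hc := h.mem_right hac
  have hb := h'.mem hbd'
  have hd := h'.mem_right hbd'
  have hcr : Cr a c b d := by
    by_contra hcon
    refine hac' (h'.max ha hc (h.ne hac) fun r s hrs hcr => ?_)
    rcases hnew r s hrs with h1 | ⟨rfl, rfl⟩ | ⟨rfl, rfl⟩
    · exact h.nc hac h1 hcr
    · exact hcon hcr
    · exact hcon (cr_swap_right.1 hcr)
  have hca := h.symm hac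
  have hdb' := h'.symm hbd'
  have hold' : ∀ x y, E x y → E' x y ∨ (x = c ∧ y = a) ∨ (x = a ∧ y = c) :=
    fun x y hxy => (hold x y hxy).imp_right Or.symm
  have hnew' : ∀ x y, E' x y → E x y ∨ (x = d ∧ y = b) ∨ (x = b ∧ y = d) :=
    fun x y hxy => (hnew x y hxy).imp_right Or.symm
  have c1 : Cr c a b d := cr_swap_left.1 hcr
  have c2 : Cr c a d b := cr_swap_right.1 c1
  have c3 : Cr a c d b := cr_swap_right.1 hcr
  exact ⟨hcr,
    ⟨h.flip_side ha hb hcr hac hbd' h' hold,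
      h'.symm (h'.flip_side hb ha (cr_comm.1 hcr) hbd' hac h hnew)⟩,
    ⟨h.symm (h.flip_side hc hb c1 hca hbd' h' hold'),
      h'.flip_side hb hc (cr_comm.1 c1) hbd' hca h hnew⟩,
    ⟨h.flip_side hc hd c2 hca hdb' h' hold',
      h'.symm (h'.flip_side hd hc (cr_comm.1 c2) hdb' hca h hnew')⟩,
    ⟨h.symm (h.flip_side ha hd c3 hac hdb' h' hold),
      h'.flip_side hd ha (cr_comm.1 c3) hdb' hac h hnew'⟩, hnew, hold⟩

/-- Exchanging the edge `p q` for `m w`. -/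
def exchange (E : ℕ → ℕ → Prop) (p q m w : ℕ) : ℕ → ℕ → Prop := fun x y =>
  (E x y ∧ ¬ (x = p ∧ y = q) ∧ ¬ (x = q ∧ y = p)) ∨ (x = m ∧ y = w) ∨ (x = w ∧ y = m)

/-- A triangulation in which the least vertex `m` misses a neighbour admits a flip that adds a
neighbour to `m`. -/
theorem Tri.exists_exchange {V E} (h : Tri V E) {m y : ℕ} (hm : m ∈ V) (hmin : ∀ x ∈ V, m ≤ x)
    (hy : y ∈ V) (hmy : m ≠ y) (hE : ¬ E m y) :
    ∃ p q w, E p q ∧ m < p ∧ m < q ∧ m < w ∧ w ∈ V ∧ ¬ E m w ∧ Tri V (exchange E p q m w) := by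
  classical
  have hlt : m < y := lt_of_le_of_ne (hmin y hy) hmy
  obtain ⟨s, hs, hms, hsy, hsb⟩ := exists_succ hy hlt
  have hEs : E m s := h.of_no_between hm hs hms hsb
  have hsy' : s ≠ y := fun h1 => hE (h1 ▸ hEs)
  obtain ⟨M, hM, hmax⟩ := V.exists_max_image id ⟨m, hm⟩
  simp only [id] at hmax
  have hyM := hmax y hy
  have hEM : E m M := h.of_no_outside hm hM (by omega) fun x hx => ⟨hmin x hx, hmax x hx⟩
  have hyM' : y ≠ M := fun h1 => hE (h1 ▸ hEM)
  -- The neighbours p and q of m closest to y on either side span a triangle with m. Its edge p q is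
  -- flipped to m w, where w is the apex below p q.
  obtain ⟨p, hp, hpm⟩ := (V.filter (fun x => x < y ∧ E m x)).exists_max_image id
    ⟨s, by simp only [Finset.mem_filter]; exact ⟨hs, by omega, hEs⟩⟩
  obtain ⟨q, hq, hqm⟩ := (V.filter (fun x => y < x ∧ E m x)).exists_min_image id
    ⟨M, by simp only [Finset.mem_filter]; exact ⟨hM, by omega, hEM⟩⟩
  simp only [Finset.mem_filter, id] at hp hpm hq hqm
  obtain ⟨hpV, hpy, hmp⟩ := hp
  obtain ⟨hqV, hyq, hmq⟩ := hq
  have hmp' : m < p := lt_of_le_of_ne (hmin p hpV) (h.ne hmp)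
  have hgap : ∀ x, p < x → x < q → ¬ E m x := by
    intro x h1 h2 h3
    have hx := h.mem_right h3
    rcases lt_trichotomy x y with h4 | rfl | h4
    · have := hpm x ⟨hx, h4, h3⟩
      omega
    · exact hE h3
    · have := hqm x ⟨hx, h4, h3⟩
      omega
  have hpq : E p q := by
    refine h.of_not_interleaved hpV hqV (by omega) fun r s hrs hlt' => ⟨fun hc => ?_, fun hc => ?_⟩
    · exact h.not_interleaved hmq hrs (by omega)
    · have hr := hmin r (h.mem hrs)
      by_cases hrm : r = m
      · subst hrm
        exact hgap s (by omega) (by omega) hrs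
      · exact h.not_interleaved hmp hrs (by omega)
  obtain ⟨w, hw, hpw, hwq, hEpw, hEwq⟩ := h.apex hpq hy hpy hyq
  have hmw : ¬ E m w := hgap w hpw hwq
  have hold : ∀ r s, r < s → E r s → Cr m w r s → r = p ∧ s = q := by
    intro r s hrs hE' hc
    rw [cr_iff (by omega) hrs] at hc
    have hr := hmin r (h.mem hE')
    have e1 := h.not_interleaved hmp hE'
    have e2 := h.not_interleaved hmq hE'
    have e3 := h.not_interleaved hEpw hE'
    have e4 := h.not_interleaved hE' hEwq
    omega
  have hold' : ∀ r s, E r s → Cr m w r s → (r = p ∧ s = q) ∨ (r = q ∧ s = p) := by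
    intro r s hE' hc
    rcases lt_or_gt_of_ne (h.ne hE') with h1 | h1
    · exact Or.inl (hold r s h1 hE' hc)
    · exact Or.inr (hold s r h1 (h.symm hE') (cr_swap_right.1 hc)).symm
  have hcr : ¬ Cr m w m w := fun hc => by
    have := hc.pairwise_ne
    omega
  refine ⟨p, q, w, hpq, hmp', by omega, by omega, hw, hmw, ?_⟩
  refine ⟨⟨?_, ?_, ?_, ?_⟩, ?_⟩
  · rintro x z (⟨h1, h2, h3⟩ | ⟨rfl, rfl⟩ | ⟨rfl, rfl⟩)
    · exact Or.inl ⟨h.symm h1, by omega, by omega⟩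
    · exact Or.inr (Or.inr ⟨rfl, rfl⟩)
    · exact Or.inr (Or.inl ⟨rfl, rfl⟩)
  · rintro x z (⟨h1, h2, h3⟩ | ⟨rfl, rfl⟩ | ⟨rfl, rfl⟩)
    · exact h.mem h1
    · exact hm
    · exact hw
  · rintro x z (⟨h1, h2, h3⟩ | ⟨rfl, rfl⟩ | ⟨rfl, rfl⟩)
    · exact h.ne h1
    · omega
    · omega
  · have key : ∀ r s, E r s ∧ ¬ (r = p ∧ s = q) ∧ ¬ (r = q ∧ s = p) → ¬ Cr m w r s := by
      rintro r s ⟨h1, h2, h3⟩ hc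
      have := hold' r s h1 hc
      omega
    rintro x z r s (h1 | ⟨rfl, rfl⟩ | ⟨rfl, rfl⟩) (h2 | ⟨rfl, rfl⟩ | ⟨rfl, rfl⟩)
    · exact h.nc h1.1 h2.1
    · exact fun hc => key x z h1 (cr_comm.1 hc)
    · exact fun hc => key x z h1 (cr_swap_left.1 (cr_comm.1 hc))
    · exact key r s h2
    · exact hcr
    · exact fun hc => hcr (cr_swap_right.1 hc)
    · exact fun hc => key r s h2 (cr_swap_left.1 hc)
    · exact fun hc => hcr (cr_swap_left.1 hc)
    · exact fun hc => hcr (cr_swap_right.1 (cr_swap_left.1 hc))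
  -- A pair that does not cross p q already belonged to E. One that crosses p q but neither m w nor
  -- a side of the quadrilateral is m w itself.
  · intro x z hx hz hxz hc
    have f1 := hc m p (Or.inl ⟨hmp, by omega, by omega⟩)
    have f2 := hc m q (Or.inl ⟨hmq, by omega, by omega⟩)
    have f3 := hc p w (Or.inl ⟨hEpw, by omega, by omega⟩)
    have f4 := hc w q (Or.inl ⟨hEwq, by omega, by omega⟩)
    have f5 := hc m w (Or.inr (Or.inl ⟨rfl, rfl⟩))
    have g1 := hmin x hx
    have g2 := hmin z hz
    have key : ∀ r s, r < s → (¬ Cr x z r s ↔ ¬ (r < x ∧ x < s ∧ (z < r ∨ s < z)) ∧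
        ¬ (r < z ∧ z < s ∧ (x < r ∨ s < x))) := by
      intro r s hrs
      unfold Cr
      omega
    rw [key _ _ (by omega)] at f1 f2 f3 f4 f5
    by_cases hpqc : Cr x z p q
    · right
      have f6 := (not_congr (key p q (by omega))).1 (not_not.2 hpqc)
      omega
    · refine Or.inl ⟨h.max hx hz hxz fun r s hrs hcr' => ?_, ?_, ?_⟩
      · by_cases h1 : (r = p ∧ s = q)
        · exact hpqc (h1.1 ▸ h1.2 ▸ hcr')
        by_cases h2 : (r = q ∧ s = p)
        · exact hpqc (cr_swap_right.1 (h2.1 ▸ h2.2 ▸ hcr'))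
        · exact hc r s (Or.inl ⟨hrs, h1, h2⟩) hcr'
      · rintro ⟨rfl, rfl⟩
        omega
      · rintro ⟨rfl, rfl⟩
        omega

/-- The fan is the only triangulation in which the least vertex is adjacent to all others. -/
theorem Tri.le_of_fan {V E E'} (h : Tri V E) (h' : Tri V E') {m : ℕ} (hmin : ∀ x ∈ V, m ≤ x)
    (hfan : ∀ x ∈ V, m ≠ x → E m x) (hfan' : ∀ x ∈ V, m ≠ x → E' m x) {x y : ℕ} (hxy : E x y) :
    E' x y := by
  wlog hlt : x < y generalizing x y
  · exact h'.symm (this (h.symm hxy) (by have := h.ne hxy; omega))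
  have hx := h.mem hxy
  have hy := h.mem_right hxy
  rcases eq_or_ne m x with rfl | hne
  · exact hfan' y hy hlt.ne
  · have := hmin x hx
    refine h'.of_no_between hx hy hlt fun w hw hc => ?_
    exact h.not_interleaved (hfan w hw (by omega)) hxy (by omega)

/-! ### Geometry of the convex polygon -/

theorem signedArea_rotate (p q r : Plane) : signedArea q r p = signedArea p q r := by
  unfold signedArea
  ring

theorem signedArea_swap (p q r : Plane) : signedArea p r q = -signedArea p q r := by
  unfold signedArea
  ring

theorem signedArea_combo (p q r s : Plane) {x y : ℝ} (h : x + y = 1) :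
    signedArea p q (x • r + y • s) = x * signedArea p q r + y * signedArea p q s := by
  obtain rfl : y = 1 - x := by linarith
  simp only [signedArea, PiLp.add_apply, PiLp.smul_apply, smul_eq_mul]
  ring

theorem signedArea_combo_self (p q : Plane) {x y : ℝ} (h : x + y = 1) :
    signedArea p q (x • p + y • q) = 0 := by
  rw [signedArea_combo p q p q h]
  unfold signedArea
  ring

variable {n : ℕ} (P : ConvexPolygon n)

theorem area_pos {i j k : Fin n} (hij : i < j) (hk : k < i ∨ j < k) :
    0 < signedArea (P.vertex i) (P.vertex j) (P.vertex k) := by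
  rcases hk with hk | hk
  · rw [signedArea_rotate]
    exact P.ccw k i j hk hij
  · exact P.ccw i j k hij hk

theorem area_neg {i j k : Fin n} (hik : i < k) (hkj : k < j) :
    signedArea (P.vertex i) (P.vertex j) (P.vertex k) < 0 := by
  rw [signedArea_swap]
  exact neg_neg_of_pos (P.ccw i k j hik hkj)

theorem area_nonneg {i j k : Fin n} (hij : i < j) (hk : ¬ (i < k ∧ k < j)) :
    0 ≤ signedArea (P.vertex i) (P.vertex j) (P.vertex k) := by
  rcases lt_trichotomy k i with h | rfl | h
  · exact (area_pos P hij (Or.inl h)).le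
  · exact le_of_eq (by unfold signedArea; ring)
  · rcases lt_trichotomy k j with h' | rfl | h'
    · exact absurd ⟨h, h'⟩ hk
    · exact le_of_eq (by unfold signedArea; ring)
    · exact (area_pos P hij (Or.inr h')).le

theorem area_nonpos {i j k : Fin n} (hik : i ≤ k) (hkj : k ≤ j) :
    signedArea (P.vertex i) (P.vertex j) (P.vertex k) ≤ 0 := by
  rcases hik.lt_or_eq with h | rfl
  · rcases hkj.lt_or_eq with h' | rfl
    · exact (area_neg P h h').le
    · exact le_of_eq (by unfold signedArea; ring)
  · exact le_of_eq (by unfold signedArea; ring)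

theorem continuous_signedArea (p q : Plane) : Continuous (signedArea p q) := by
  unfold signedArea
  fun_prop

/-- Diagonals with interleaved endpoints meet in the interior of the polygon. -/
theorem exists_mem_interior {i j k l : Fin n} (hik : i < k) (hkj : k < j) (hjl : j < l) :
    ∃ x ∈ openSegment ℝ (P.vertex i) (P.vertex j), x ∈ openSegment ℝ (P.vertex k) (P.vertex l) ∧
      x ∈ interior P.region := by
  have hα := area_pos P (hkj.trans hjl) (Or.inl hik)
  have hβ := area_neg P hkj hjl
  have hγ := area_pos P (hik.trans hkj) (Or.inr hjl)
  have hδ := area_neg P hik hkj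
  have hmem : ∀ u, P.vertex u ∈ P.region := fun u => subset_convexHull ℝ _ (Set.mem_range_self u)
  have hconv : Convex ℝ P.region := convex_convexHull ℝ _
  have hA := hmem i
  have hB := hmem j
  have hC := hmem k
  have hD := hmem l
  generalize P.vertex i = A at *
  generalize P.vertex j = B at *
  generalize P.vertex k = C at *
  generalize P.vertex l = D at *
  -- N normalises the signed areas: dividing by it gives the parameters of the intersection point on
  -- both diagonals.
  obtain ⟨N, hN⟩ : ∃ N, N = signedArea C D A - signedArea C D B := ⟨_, rfl⟩
  have hN' : N = signedArea A B D - signedArea A B C := by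
    rw [hN]
    unfold signedArea
    ring
  have hpos : 0 < N := by linarith
  have hne := hpos.ne'
  have hx : (1 - signedArea C D A / N) • A + (signedArea C D A / N) • B =
      (1 + signedArea A B C / N) • C + (-signedArea A B C / N) • D := by
    ext t
    fin_cases t
    all_goals
      simp only [PiLp.add_apply, PiLp.smul_apply, smul_eq_mul, Fin.zero_eta, Fin.mk_one]
      field_simp
      rw [hN]
      unfold signedArea
      ring
  have e1 : 0 < signedArea C D A / N := by positivity
  have e2 : signedArea C D A / N < 1 := by
    rw [div_lt_one hpos]
    linarith
  have e3 : 0 < -signedArea A B C / N := div_pos (by linarith) hpos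
  have e4 : -signedArea A B C / N < 1 := by
    rw [div_lt_one hpos]
    linarith
  have e5 : 1 + signedArea A B C / N = 1 - -signedArea A B C / N := by ring
  refine ⟨_, ⟨_, _, by linarith, e1, sub_add_cancel _ _, rfl⟩,
    ⟨_, _, by linarith, e3, by rw [e5]; exact sub_add_cancel _ _, hx.symm⟩, ?_⟩
  have hz1 : signedArea A B ((1 - signedArea C D A / N) • A + (signedArea C D A / N) • B) = 0 :=
    signedArea_combo_self A B (sub_add_cancel _ _)
  have hz2 : signedArea C D ((1 - signedArea C D A / N) • A + (signedArea C D A / N) • B) = 0 := by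
    rw [hx]
    exact signedArea_combo_self C D (by ring)
  -- These functions are parameters t and u such that w is the midpoint of the point t of A B and
  -- the point u of C D. Where both lie in (0, 1), w is in the polygon; this gives an open
  -- neighbourhood of the intersection point.
  have hcont1 : Continuous fun w => signedArea C D A / N - 2 * signedArea C D w / N :=
    continuous_const.sub ((continuous_const.mul (continuous_signedArea C D)).div_const N)
  have hcont2 : Continuous fun w => -signedArea A B C / N + 2 * signedArea A B w / N :=
    continuous_const.add ((continuous_const.mul (continuous_signedArea A B)).div_const N)
  refine mem_interior.2 ⟨_, ?_, ((isOpen_Ioo (a := 0) (b := 1)).preimage hcont1).inter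
    ((isOpen_Ioo (a := 0) (b := 1)).preimage hcont2), ?_⟩
  · rintro w ⟨⟨h1, h2⟩, ⟨h3, h4⟩⟩
    simp only at h1 h2 h3 h4
    obtain ⟨t, ht⟩ : ∃ t, t = signedArea C D A / N - 2 * signedArea C D w / N := ⟨_, rfl⟩
    obtain ⟨u, hu⟩ : ∃ u, u = -signedArea A B C / N + 2 * signedArea A B w / N := ⟨_, rfl⟩
    rw [← ht] at h1 h2
    rw [← hu] at h3 h4
    have hw : w = (1 / 2 : ℝ) • ((1 - t) • A + t • B) + (1 / 2 : ℝ) • ((1 - u) • C + u • D) := by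
      rw [ht, hu]
      ext v
      fin_cases v
      all_goals
        simp only [PiLp.add_apply, PiLp.smul_apply, smul_eq_mul, Fin.zero_eta, Fin.mk_one]
        field_simp
        rw [hN]
        unfold signedArea
        ring
    rw [hw]
    exact hconv (hconv hA hB (by linarith) h1.le (by ring)) (hconv hC hD (by linarith) h3.le (by ring))
      (by norm_num) (by norm_num) (by norm_num)
  · simp only [Set.mem_inter_iff, Set.mem_preimage, hz1, hz2, mul_zero, zero_div, sub_zero,
      add_zero, Set.mem_Ioo]
    exact ⟨⟨e1, e2⟩, ⟨e3, e4⟩⟩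

/-- Without interleaving, k and l lie weakly on one side of the line through i and j, and not both
on it. So the signed area has no zero on the open segment k l. -/
theorem disjoint_of_not_cr {i j k l : Fin n} (hij : i < j) (hkl : k < l) (hne : ¬ (i = k ∧ j = l))
    (hcr : ¬ Cr i j k l) : Disjoint (openSegment ℝ (P.vertex i) (P.vertex j))
      (openSegment ℝ (P.vertex k) (P.vertex l)) := by
  rw [Set.disjoint_left]
  rintro x ⟨a, b, ha, hb, hab, rfl⟩ ⟨c, d, hc, hd, hcd, he⟩
  have h0 := signedArea_combo_self (P.vertex i) (P.vertex j) hab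
  rw [← he, signedArea_combo _ _ _ _ hcd] at h0
  simp only [Cr, Fin.val_fin_lt] at hcr
  by_cases hin : i ≤ k ∧ l ≤ j
  · have h1 := area_nonpos P hin.1 (hkl.le.trans hin.2)
    have h2 := area_nonpos P (hin.1.trans hkl.le) hin.2
    rcases hin.1.lt_or_eq with h3 | h3
    · have := area_neg P h3 (hkl.trans_le hin.2)
      nlinarith
    · have h4 : l < j := lt_of_le_of_ne hin.2 fun h4 => hne ⟨h3, h4.symm⟩
      have := area_neg P (h3 ▸ hkl) h4
      nlinarith
  · have hk : ¬ (i < k ∧ k < j) := by omega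
    have hl : ¬ (i < l ∧ l < j) := by omega
    have h1 := area_nonneg P hij hk
    have h2 := area_nonneg P hij hl
    have h3 : (k < i ∨ j < k) ∨ (l < i ∨ j < l) := by omega
    rcases h3 with h3 | h3
    · have := area_pos P hij h3
      nlinarith
    · have := area_pos P hij h3
      nlinarith

theorem crossing_of_cr {i j k l : Fin n} (h : Cr i j k l) : P.Crossing s(i, j) s(k, l) := by
  wlog hij : i < j generalizing i j
  · have h1 := h.pairwise_ne
    rw [Sym2.eq_swap]
    exact this (cr_swap_left.1 h) (by omega)
  wlog hkl : k < l generalizing k l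
  · have h1 := h.pairwise_ne
    rw [@Sym2.eq_swap _ k l]
    exact this (cr_swap_right.1 h) (by omega)
  refine Set.not_disjoint_iff.2 ?_
  rcases (cr_iff (Fin.lt_def.1 hij) (Fin.lt_def.1 hkl)).1 h with ⟨h1, h2, h3⟩ | ⟨h1, h2, h3⟩
  · obtain ⟨x, hx, hx', -⟩ := exists_mem_interior P (i := i) (j := j) (k := k) (l := l) h1 h2 h3
    exact ⟨x, hx, hx'⟩
  · obtain ⟨x, hx, hx', -⟩ := exists_mem_interior P (i := k) (j := l) (k := i) (l := j) h1 h2 h3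
    exact ⟨x, hx', hx⟩

/-- The edges must be distinct: an edge meets its own relative interior, but its ends do not
interleave with themselves. -/
theorem crossing_iff {i j k l : Fin n} (hij : i ≠ j) (hkl : k ≠ l) (hne : s(i, j) ≠ s(k, l)) :
    P.Crossing s(i, j) s(k, l) ↔ Cr i j k l := by
  refine ⟨fun h => ?_, crossing_of_cr P⟩
  wlog hij' : i < j generalizing i j
  · rw [cr_swap_left]
    exact this hij.symm (by rwa [Sym2.eq_swap]) (by rwa [Sym2.eq_swap]) (by omega)
  wlog hkl' : k < l generalizing k l
  · rw [cr_swap_right]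
    exact this hkl.symm (by rwa [@Sym2.eq_swap _ l k]) (by rwa [@Sym2.eq_swap _ l k]) (by omega)
  by_contra hcr
  exact h (disjoint_of_not_cr P hij' hkl' (by rintro ⟨rfl, rfl⟩; exact hne rfl) hcr)

theorem not_isBoundaryEdge_of_cr {i j k l : Fin n} (h : Cr i j k l) :
    ¬ P.IsBoundaryEdge s(i, j) := by
  wlog hij : i < j generalizing i j
  · have h1 := h.pairwise_ne
    rw [Sym2.eq_swap]
    exact this (cr_swap_left.1 h) (by omega)
  wlog hkl : k < l generalizing k l
  · have h1 := h.pairwise_ne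
    exact this (cr_swap_right.1 h) (by omega)
  rintro ⟨-, hd⟩
  rcases (cr_iff (Fin.lt_def.1 hij) (Fin.lt_def.1 hkl)).1 h with ⟨h1, h2, h3⟩ | ⟨h1, h2, h3⟩
  · obtain ⟨x, hx, -, hi⟩ := exists_mem_interior P (i := i) (j := j) (k := k) (l := l) h1 h2 h3
    exact Set.disjoint_left.1 hd (openSegment_subset_segment ℝ _ _ hx) hi
  · obtain ⟨x, -, hx, hi⟩ := exists_mem_interior P (i := k) (j := l) (k := i) (l := j) h1 h2 h3
    exact Set.disjoint_left.1 hd (openSegment_subset_segment ℝ _ _ hx) hi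

/-! ### Translation between polygons and relations -/

/-- The relation on the naturals given by a set of edges. -/
def edgeRel (S : Finset (Sym2 (Fin n))) (x y : ℕ) : Prop :=
  ∃ (hx : x < n) (hy : y < n), s(⟨x, hx⟩, ⟨y, hy⟩) ∈ S

theorem edgeRel_val {S : Finset (Sym2 (Fin n))} {i j : Fin n} : edgeRel S i j ↔ s(i, j) ∈ S :=
  ⟨fun ⟨_, _, h⟩ => h, fun h => ⟨i.2, j.2, h⟩⟩

theorem edgeRel_ext {S S' : Finset (Sym2 (Fin n))} (h : ∀ x y, edgeRel S x y → edgeRel S' x y) :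
    S ⊆ S' := by
  intro e
  induction e with
  | _ i j => exact fun he => edgeRel_val.1 (h i j (edgeRel_val.2 he))

theorem edgeRel_symm {S : Finset (Sym2 (Fin n))} {x y : ℕ} : edgeRel S x y → edgeRel S y x :=
  fun ⟨hx, hy, h⟩ => ⟨hy, hx, by rwa [Sym2.eq_swap]⟩

theorem isNonCrossing_iff {S : Finset (Sym2 (Fin n))} :
    P.IsNonCrossing S ↔ NC (Finset.range n) (edgeRel S) := by
  constructor
  · rintro ⟨h1, h2⟩
    have hne : ∀ i j : Fin n, s(i, j) ∈ S → i ≠ j := fun i j h h3 => h1 _ h (by simpa using h3)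
    refine ⟨edgeRel_symm, fun ⟨hx, _, _⟩ => Finset.mem_range.2 hx, ?_, ?_⟩
    · rintro x y ⟨hx, hy, h⟩ rfl
      exact hne _ _ h rfl
    · rintro p q r s ⟨hp, hq, h⟩ ⟨hr, hs, h'⟩ hcr
      refine h2 _ h _ h' (fun he => ?_) (crossing_of_cr P hcr)
      have := hcr.pairwise_ne
      simp only [Sym2.eq_iff, Fin.mk.injEq] at he
      omega
  · intro h
    have hne : ∀ i j : Fin n, s(i, j) ∈ S → i ≠ j := fun i j hij h3 =>
      h.ne (edgeRel_val.2 hij) (congrArg Fin.val h3)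
    refine ⟨?_, ?_⟩
    · intro e he
      induction e with
      | _ i j => simpa using hne i j he
    · intro e he f hf hef
      induction e with
      | _ i j =>
      induction f with
      | _ k l =>
      rw [crossing_iff P (hne i j he) (hne k l hf) hef]
      exact h.nc (edgeRel_val.2 he) (edgeRel_val.2 hf)

theorem edgeRel_insert {S : Finset (Sym2 (Fin n))} {i j : Fin n} :
    edgeRel (insert s(i, j) S) = insertPair (edgeRel S) i j := by
  funext x y
  refine propext ⟨?_, ?_⟩
  · rintro ⟨hx, hy, h⟩
    rw [Finset.mem_insert, Sym2.eq_iff] at h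
    rcases h with (⟨h1, h2⟩ | ⟨h1, h2⟩) | h
    · exact Or.inr (Or.inl ⟨congrArg Fin.val h1, congrArg Fin.val h2⟩)
    · exact Or.inr (Or.inr ⟨congrArg Fin.val h1, congrArg Fin.val h2⟩)
    · exact Or.inl ⟨hx, hy, h⟩
  · rintro (⟨hx, hy, h⟩ | ⟨rfl, rfl⟩ | ⟨rfl, rfl⟩)
    · exact ⟨hx, hy, Finset.mem_insert_of_mem h⟩
    · exact edgeRel_val.2 (Finset.mem_insert_self _ _)
    · exact edgeRel_symm (edgeRel_val.2 (Finset.mem_insert_self _ _))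

variable {P} in
theorem tri_edgeRel (T : P.Triangulation) : Tri (Finset.range n) (edgeRel T.edges) := by
  have h := (isNonCrossing_iff P).1 T.maximal.1
  refine { h with max := ?_ }
  intro x y hx hy hxy hcr
  rw [Finset.mem_range] at hx hy
  obtain ⟨i, rfl⟩ : ∃ i : Fin n, (i : ℕ) = x := ⟨⟨x, hx⟩, rfl⟩
  obtain ⟨j, rfl⟩ : ∃ j : Fin n, (j : ℕ) = y := ⟨⟨y, hy⟩, rfl⟩
  have h1 := h.insertPair (Finset.mem_range.2 hx) (Finset.mem_range.2 hy) hxy hcr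
  rw [← edgeRel_insert, ← isNonCrossing_iff P] at h1
  exact edgeRel_val.2 (T.maximal.2 h1 (Finset.subset_insert _ _) (Finset.mem_insert_self _ _))

theorem exists_triangulation {E : ℕ → ℕ → Prop} (h : Tri (Finset.range n) E) :
    ∃ T : P.Triangulation, edgeRel T.edges = E := by
  classical
  obtain ⟨S, hS⟩ : ∃ S : Finset (Sym2 (Fin n)), edgeRel S = E := by
    refine ⟨Finset.univ.filter fun e => Sym2.lift ⟨fun i j : Fin n => E i j, fun i j =>
      propext ⟨h.symm, h.symm⟩⟩ e, ?_⟩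
    funext x y
    refine propext ⟨?_, fun hxy => ?_⟩
    · rintro ⟨hx, hy, hxy⟩
      simpa using hxy
    · have hx := Finset.mem_range.1 (h.mem hxy)
      have hy := Finset.mem_range.1 (h.mem_right hxy)
      exact ⟨hx, hy, by simpa using hxy⟩
  refine ⟨⟨S, (isNonCrossing_iff P).2 (hS ▸ h.toNC), fun S' hS' hle => edgeRel_ext fun x y hxy => ?_⟩,
    hS⟩
  have h' := (isNonCrossing_iff P).1 hS'
  rw [hS]
  refine h.max (h'.mem hxy) (h'.mem_right hxy) (h'.ne hxy) fun r s hrs => ?_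
  rw [← hS] at hrs
  obtain ⟨hr, hs, hrs⟩ := hrs
  exact h'.nc hxy ⟨hr, hs, hle hrs⟩

variable {P}

theorem triangulation_ext {T U : P.Triangulation} (h : T.edges = U.edges) : T = U := by
  cases T
  cases U
  congr

theorem finite_triangulation : Finite P.Triangulation :=
  Finite.of_injective (fun T => T.edges) fun _ _ => triangulation_ext

theorem sdiff_edge {S S' : Finset (Sym2 (Fin n))} {i j : Fin n} (h : S \ S' = {s(i, j)}) (x y : ℕ)
    (hxy : edgeRel S x y) : edgeRel S' x y ∨ (x = i ∧ y = j) ∨ (x = j ∧ y = i) := by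
  obtain ⟨hx, hy, hS⟩ := hxy
  by_cases h' : s(⟨x, hx⟩, ⟨y, hy⟩) ∈ S'
  · exact Or.inl ⟨hx, hy, h'⟩
  · have h1 : s(⟨x, hx⟩, ⟨y, hy⟩) ∈ ({s(i, j)} : Finset (Sym2 (Fin n))) :=
      h ▸ Finset.mem_sdiff.2 ⟨hS, h'⟩
    rw [Finset.mem_singleton, Sym2.eq_iff] at h1
    rcases h1 with ⟨h1, h2⟩ | ⟨h1, h2⟩
    · exact Or.inr (Or.inl ⟨congrArg Fin.val h1, congrArg Fin.val h2⟩)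
    · exact Or.inr (Or.inr ⟨congrArg Fin.val h1, congrArg Fin.val h2⟩)

theorem exists_flip_of_adj {T U : P.Triangulation} (h : P.flipGraph.Adj T U) :
    ∃ a b c d, Flip (edgeRel T.edges) (edgeRel U.edges) a b c d := by
  obtain ⟨e, he⟩ := Finset.card_eq_one.1 h.1
  obtain ⟨f, hf⟩ := Finset.card_eq_one.1 h.2
  induction e with
  | _ a c =>
  induction f with
  | _ b d =>
  have h1 := Finset.mem_sdiff.1 (he ▸ Finset.mem_singleton_self s(a, c))
  have h2 := Finset.mem_sdiff.1 (hf ▸ Finset.mem_singleton_self s(b, d))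
  exact ⟨a, b, c, d, (tri_edgeRel T).flip (tri_edgeRel U) (edgeRel_val.2 h1.1)
    (fun h3 => h1.2 (edgeRel_val.1 h3)) (edgeRel_val.2 h2.1) (sdiff_edge hf) (sdiff_edge he)⟩

theorem adj_of_exchange {T U : P.Triangulation} {p q m w : ℕ} (hpq : edgeRel T.edges p q)
    (hmw : ¬ edgeRel T.edges m w) (hU : edgeRel U.edges = exchange (edgeRel T.edges) p q m w) :
    P.flipGraph.Adj T U := by
  have hT := tri_edgeRel T
  have hmw' : edgeRel U.edges m w := by
    rw [hU]
    exact Or.inr (Or.inl ⟨rfl, rfl⟩)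
  have hpq' : ¬ edgeRel U.edges p q := by
    rw [hU]
    rintro (h | ⟨rfl, rfl⟩ | ⟨rfl, rfl⟩)
    · exact h.2.1 ⟨rfl, rfl⟩
    · exact hmw hpq
    · exact hmw (hT.symm hpq)
  obtain ⟨hp, hq, h1⟩ := hpq
  obtain ⟨hm, hw, h2⟩ := hmw'
  have key : ∀ {x y : ℕ} {hx : x < n} {hy : y < n} {i j : Fin n}, (x = i ∧ y = j) ∨ (x = j ∧ y = i) →
      s((⟨x, hx⟩ : Fin n), ⟨y, hy⟩) = s(i, j) := by
    rintro x y hx hy i j (⟨rfl, rfl⟩ | ⟨rfl, rfl⟩)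
    · rfl
    · exact Sym2.eq_swap
  constructor
  · refine Finset.card_eq_one.2 ⟨s(⟨p, hp⟩, ⟨q, hq⟩), Finset.eq_singleton_iff_unique_mem.2
      ⟨Finset.mem_sdiff.2 ⟨h1, fun h3 => hpq' ⟨hp, hq, h3⟩⟩, ?_⟩⟩
    intro e he
    induction e with
    | _ i j =>
    rw [Finset.mem_sdiff, ← edgeRel_val, ← edgeRel_val, hU] at he
    refine key ?_
    have := he.1
    have := he.2
    unfold exchange at this
    tauto
  · refine Finset.card_eq_one.2 ⟨s(⟨m, hm⟩, ⟨w, hw⟩), Finset.eq_singleton_iff_unique_mem.2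
      ⟨Finset.mem_sdiff.2 ⟨h2, fun h3 => hmw ⟨hm, hw, h3⟩⟩, ?_⟩⟩
    intro e he
    induction e with
    | _ i j =>
    rw [Finset.mem_sdiff, ← edgeRel_val, ← edgeRel_val, hU] at he
    refine key ?_
    have := he.1
    unfold exchange at this
    tauto

/-! ### Connectivity, interior degrees and the theorem -/

-- Each exchange raises the degree of the vertex 0, which is bounded.
open Classical in
theorem exists_reachable_fan (T : P.Triangulation) : ∃ F : P.Triangulation,
    P.flipGraph.Reachable T F ∧ ∀ x ∈ Finset.range n, 0 ≠ x → edgeRel F.edges 0 x := by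
  obtain ⟨N, hN⟩ : ∃ N, N = n - ((Finset.range n).filter (edgeRel T.edges 0)).card := ⟨_, rfl⟩
  induction N using Nat.strong_induction_on generalizing T with
  | _ N ih =>
  by_cases hfan : ∀ x ∈ Finset.range n, 0 ≠ x → edgeRel T.edges 0 x
  · exact ⟨T, SimpleGraph.Reachable.refl T, hfan⟩
  push Not at hfan
  obtain ⟨y, hy, h0y, hE⟩ := hfan
  have h0 : 0 ∈ Finset.range n := Finset.mem_range.2 (by have := P.three_le; omega)
  obtain ⟨p, q, w, hpq, h0p, h0q, h0w, hw, hEw, hex⟩ :=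
    (tri_edgeRel T).exists_exchange h0 (fun x _ => Nat.zero_le x) hy h0y hE
  obtain ⟨U, hU⟩ := exists_triangulation P hex
  have hlt : ((Finset.range n).filter (edgeRel T.edges 0)).card <
      ((Finset.range n).filter (edgeRel U.edges 0)).card := by
    refine Finset.card_lt_card (Finset.ssubset_iff_of_subset (fun x hx => ?_) |>.2 ⟨w, ?_, ?_⟩)
    · rw [Finset.mem_filter] at hx ⊢
      rw [hU]
      exact ⟨hx.1, Or.inl ⟨hx.2, by omega, by omega⟩⟩
    · rw [Finset.mem_filter, hU]
      exact ⟨hw, Or.inr (Or.inl ⟨rfl, rfl⟩)⟩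
    · rw [Finset.mem_filter]
      exact fun h => hEw h.2
  have hle := Finset.card_filter_le (Finset.range n) (edgeRel U.edges 0)
  rw [Finset.card_range] at hle
  obtain ⟨F, hF, hfan⟩ := ih _ (by omega) U rfl
  exact ⟨F, (adj_of_exchange hpq hEw hU).reachable.trans hF, hfan⟩

theorem preconnected_flipGraph : P.flipGraph.Preconnected := by
  intro T U
  obtain ⟨F, hF, h1⟩ := exists_reachable_fan T
  obtain ⟨F', hF', h2⟩ := exists_reachable_fan U
  have hle : ∀ {F F' : P.Triangulation},
      (∀ x ∈ Finset.range n, 0 ≠ x → edgeRel F.edges 0 x) →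
      (∀ x ∈ Finset.range n, 0 ≠ x → edgeRel F'.edges 0 x) → F.edges ⊆ F'.edges :=
    fun h1 h2 => edgeRel_ext fun x y hxy =>
      (tri_edgeRel _).le_of_fan (tri_edgeRel _) (fun x _ => Nat.zero_le x) h1 h2 hxy
  obtain rfl : F = F' := triangulation_ext ((hle h1 h2).antisymm (hle h2 h1))
  exact hF.trans hF'.symm

theorem eccent_ne_top (T : P.Triangulation) : P.flipGraph.eccent T ≠ ⊤ := by
  have : Finite P.Triangulation := finite_triangulation
  have : Nonempty P.Triangulation := ⟨T⟩
  obtain ⟨U, hU⟩ := P.flipGraph.exists_edist_eq_eccent_of_finite T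
  rw [← hU, SimpleGraph.edist_ne_top_iff_reachable]
  exact preconnected_flipGraph T U

theorem exists_flipPath {T U : P.Triangulation} (w : P.flipGraph.Walk T U) :
    ∃ G a b c d, FlipPath (Finset.range n) w.length G a b c d (Finset.range w.length) ∧
      G 0 = edgeRel T.edges ∧ G w.length = edgeRel U.edges := by
  have h : ∀ t, ∃ f : ℕ × ℕ × ℕ × ℕ, t < w.length → Flip (edgeRel (w.getVert t).edges)
      (edgeRel (w.getVert (t + 1)).edges) f.1 f.2.1 f.2.2.1 f.2.2.2 := by
    intro t
    by_cases ht : t < w.length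
    · obtain ⟨a, b, c, d, hf⟩ := exists_flip_of_adj (w.adj_getVert_succ ht)
      exact ⟨(a, b, c, d), fun _ => hf⟩
    · exact ⟨(0, 0, 0, 0), fun h => absurd h ht⟩
  choose f hf using h
  refine ⟨fun t => edgeRel (w.getVert t).edges, fun t => (f t).1, fun t => (f t).2.1,
    fun t => (f t).2.2.1, fun t => (f t).2.2.2, ⟨edgeRel_symm, (tri_edgeRel _).mem,
    (tri_edgeRel _).ne, fun t ht => Or.inl ⟨Finset.mem_range.2 ht, hf t ht⟩⟩, ?_, ?_⟩
  · simp only [SimpleGraph.Walk.getVert_zero]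
  · simp only [SimpleGraph.Walk.getVert_length]

-- An edge from v to any vertex other than its cyclic neighbours a and b crosses a b and is
-- therefore interior, so at most two neighbours are lost.
open Classical in
theorem degree_le (T : P.Triangulation) (v : Fin n) :
    ((Finset.range n).filter (edgeRel T.edges v)).card ≤ T.interiorDegree v + 2 := by
  obtain ⟨a, ha, han⟩ : ∃ a : ℕ, (a = v + 1 ∨ a = 0 ∧ (v : ℕ) + 1 = n) ∧ a < n := by
    by_cases h : (v : ℕ) + 1 < n
    · exact ⟨v + 1, Or.inl rfl, h⟩
    · exact ⟨0, Or.inr ⟨rfl, by omega⟩, by omega⟩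
  obtain ⟨b, hb, hbn⟩ : ∃ b : ℕ, (b + 1 = (v : ℕ) ∨ b + 1 = n ∧ (v : ℕ) = 0) ∧ b < n := by
    by_cases h : (v : ℕ) = 0
    · exact ⟨n - 1, Or.inr ⟨by omega, h⟩, by omega⟩
    · exact ⟨v - 1, Or.inl (by omega), by omega⟩
  have h1 := Finset.le_card_sdiff {a, b} ((Finset.range n).filter (edgeRel T.edges v))
  have h2 := Finset.card_le_two (a := a) (b := b)
  suffices hs : (((Finset.range n).filter (edgeRel T.edges v)) \ {a, b}).card ≤
      T.interiorDegree v by omega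
  refine Finset.card_le_card_of_injOn (fun x => if h : x < n then s(v, ⟨x, h⟩) else s(v, v)) ?_ ?_
  · intro x hx
    rw [Finset.mem_coe, Finset.mem_sdiff, Finset.mem_filter, Finset.mem_insert,
      Finset.mem_singleton, Finset.mem_range] at hx
    obtain ⟨⟨hxn, hE⟩, hx2⟩ := hx
    have hne := (tri_edgeRel T).ne hE
    obtain ⟨_, _, hE'⟩ := hE
    have hcr : Cr v (⟨x, hxn⟩ : Fin n) (⟨a, han⟩ : Fin n) (⟨b, hbn⟩ : Fin n) := by
      unfold Cr
      simp only
      omega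
    simp only [hxn, dif_pos, Finset.mem_coe, Finset.mem_filter,
      ConvexPolygon.Triangulation.interiorEdges]
    exact ⟨⟨hE', not_isBoundaryEdge_of_cr P hcr⟩, Sym2.mem_mk_left _ _⟩
  · intro x hx y hy hxy
    rw [Finset.mem_coe, Finset.mem_sdiff, Finset.mem_filter, Finset.mem_range] at hx hy
    have hvx := (tri_edgeRel T).ne hx.1.2
    simp only [dif_pos hx.1.1, dif_pos hy.1.1, Sym2.eq_iff, Fin.mk.injEq, true_and] at hxy
    rcases hxy with h | ⟨h, h'⟩
    · exact h
    · exact absurd (congrArg Fin.val h').symm hvx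

end FlipGraph

theorem mainTheorem3 (n : ℕ) (P : ConvexPolygon n) (T : P.Triangulation) (k : ℤ)
    (hT : ∀ v : Fin n, (T.interiorDegree v : ℤ) ≤ (n : ℤ) - 3 - k) :
    P.flipGraph.eccent T ≠ ⊤ ∧
      (n : ℝ) + ((k : ℝ) - 21) / 4 ≤ ((P.flipGraph.eccent T).toNat : ℝ) := by
  classical
  refine ⟨FlipGraph.eccent_ne_top T, ?_⟩
  have hn := P.three_le
  have hnk := hT ⟨0, by omega⟩
  -- The degree bound is a natural number because it bounds the degree of the vertex 0.
  obtain ⟨D, hD⟩ := Int.eq_ofNat_of_zero_le (show 0 ≤ (n : ℤ) - 3 - k by omega)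
  obtain ⟨E', hE', hfar⟩ := (FlipGraph.tri_edgeRel T).exists_far_of_degree_le (D := D)
    (by rwa [Finset.card_range]) (fun v hv => by
      have h1 := FlipGraph.degree_le T ⟨v, Finset.mem_range.1 hv⟩
      have h2 := hT ⟨v, Finset.mem_range.1 hv⟩
      have h3 := h1.trans (show _ ≤ D + 2 by omega)
      convert h3)
  obtain ⟨U, hU⟩ := FlipGraph.exists_triangulation P hE'
  obtain ⟨w, hw⟩ := (FlipGraph.preconnected_flipGraph T U).exists_walk_length_eq_edist
  obtain ⟨G, a, b, c, d, hG, hG0, hGl⟩ := FlipGraph.exists_flipPath w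
  have h1 := hfar _ _ _ _ _ _ _ hG hG0 (hGl.trans hU)
  rw [Finset.card_range, Finset.card_range] at h1
  have h2 : w.length ≤ (P.flipGraph.eccent T).toNat := by
    have h3 := P.flipGraph.edist_le_eccent (u := T) (v := U)
    rw [← hw] at h3
    exact_mod_cast (ENat.natCast_toNat (FlipGraph.eccent_ne_top T)).symm ▸ h3
  have h4 : 4 * (n : ℤ) + k - 21 ≤ 4 * ((P.flipGraph.eccent T).toNat : ℤ) := by omega
  have h5 : 4 * (n : ℝ) + k - 21 ≤ 4 * ((P.flipGraph.eccent T).toNat : ℝ) := by exact_mod_cast h4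
  linarith
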